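/- **Setting.** All edge weights are i.i.d. nonnegative real random variables with a common atomless law $F$ (that is, with continuous distribution function), independent of the graph when the graph is random. For a finite graph $G$, $\mathcal{M}_G$ denotes the (almost surely unique) matching $M\subseteq E(G)$ maximizing $\sum_{e\in M}w_e$, and $\mathsf{W}_G=\sum_{e\in\mathcal{M}_G}w_e$ is its weight. For a locally finite connected graph $G$, $e\in E(G)$ and $r\ge 1$, let $\mathbb{B}^r_e(G)$ be the subgraph of $G$ induced by the vertices at graph distance at most $r$ from an endpoint of $e$, and let $\partial \mathbb{B}^r_e(G)$ be the set of vertices of $\mathbb{B}^r_e(G)$ which have a $G$-neighbour outside it. Set $$\varrho_r(G,e)=\mathbf{E}\sup_{A\subseteq\partial\mathbb{B}^r_e(G)}\bigl|\mathbf{1}_{\{e\in\mathcal{M}_{\mathbb{B}^r_e(G)}\}}-\mathbf{1}_{\{e\in\mathcal{M}_{\mathbb{B}^r_e(G)\setminus A}\}}\bigr| .$$ The graph $G$ satisfies *correlation decay* if $\varrho_r(G,e)\to0$ as $r\to\infty$ for every $e\in E(G)$. In this case let $\mathcal{M}_G$ be the set of edges $e$ with $\lim_{n}\mathbf{1}_{\{e\in\mathcal{M}_{H_n}\}}=1$,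 where $(H_n)$ is any sequence of finite subgraphs increasing to $G$ (chosen without looking at the weights). The space of (isomorphism classes of) connected locally finite rooted graphs carries the local metric $d_{\mathrm{loc}}=1/(R+1)$, where $R$ is the supremum of the integers $r\ge0$ for which the balls of radius $r$ around the two roots are isomorphic as rooted graphs. For finite random graphs $G_n$ and, given $G_n$, a uniformly chosen vertex $o_n$ of $G_n$, we say that $(G_n,o_n)$ converges locally weakly to a random connected locally finite rooted graph $(G,o)$ if $\mathbf{E}\,h(G_n,o_n)\to\mathbf{E}\,h(G,o)$ for every bounded $d_{\mathrm{loc}}$-continuous $h$, where $h(G_n,o_n)$ is evaluated at the connected component of $o_n$ in $G_n$, rooted at $o_n$. **Statement.** Let $(G_n)$ be a sequence of (nonempty) finite random graphs such that $(G_n,o_n)$ converges locally weakly to $(G,o)$, where $o_n$ is uniform on $V(G_n)$. Assume that $\sup_n\mathbf{E}\frac{|E(G_n)|}{|V(G_n)|}<\infty$, that $\mathbf{E}|w_e|^p<\infty$ for some $p>1$, and that almost surely the limit graph $G$ satisfies correlation decay. Then $$\lim_{n\to\infty}\mathbf{E}\frac{\mathsf{W}_{G_n}}{|V(G_n)|}=\frac12\,\mathbf{E}\Bigl[\sum_{v:\,v\sim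 o}w_{(ov)}\mathbf{1}_{\{(ov)\in\mathcal{M}_G\}}\Bigr] \quad\text{and}\quad \lim_{n\to\infty}\mathbf{E}\frac{|\mathcal{M}_{G_n}|}{|V(G_n)|}=\frac12\,\mathbf{E}\Bigl[\sum_{v:\,v\sim o}\mathbf{1}_{\{(ov)\in\mathcal{M}_G\}}\Bigr],$$ where $|\mathcal{M}_{G_n}|$ is the number of edges of $\mathcal{M}_{G_n}$, the expectations are over both the graph and the weights, and all of these expectations are finite. -/

import Mathlib

open MeasureTheory Filter Topology

namespace MaxMatching

/-! ### Matchings in (subgraphs of) an edge-weighted graph -/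

section Matching

variable {V : Type} {G : SimpleGraph V}

/-- A finite set of edges is a matching if no two distinct edges of it share a vertex. -/
def IsMatching (M : Finset G.edgeSet) : Prop :=
  ∀ e ∈ M, ∀ e' ∈ M, e ≠ e' → ∀ v : V, v ∈ (e : Sym2 V) → v ∉ (e' : Sym2 V)

/-- `M` is a maximum weight matching of the (finite) subgraph `H` of `G`, for the edge weights `w`. -/
structure IsMWM (H : G.Subgraph) (w : G.edgeSet → ℝ) (M : Finset G.edgeSet) : Prop where
  subset : ∀ e ∈ M, (e : Sym2 V) ∈ H.edgeSet
  isMatching : IsMatching M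
  maximal : ∀ M' : Finset G.edgeSet, (∀ e ∈ M', (e : Sym2 V) ∈ H.edgeSet) → IsMatching M' →
    ∑ e ∈ M', w e ≤ ∑ e ∈ M, w e

/-- The maximum weight matching of a finite subgraph `H` of `G`. It is the unique `M` with
`IsMWM H w M` whenever there is only one (see `mwm_eq`), which is almost surely the case for i.i.d.
weights with an atomless law; by convention, if there are several, it is their intersection. -/
def mwm (H : G.Subgraph) (w : G.edgeSet → ℝ) : Set G.edgeSet :=
  {e | ∀ M : Finset G.edgeSet, IsMWM H w M → e ∈ M}

theorem mwm_eq (H : G.Subgraph) (w : G.edgeSet → ℝ) (M : Finset G.edgeSet) (hM : IsMWM H w M)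
    (huniq : ∀ M', IsMWM H w M' → M' = M) : mwm H w = (M : Set G.edgeSet) := by
  ext e
  constructor
  · intro h
    exact h M hM
  · intro h M' hM'
    rw [huniq M' hM']
    exact h

/-- The law of i.i.d. edge weights with common law `F` on the edges of `G`. -/
noncomputable def weightLaw (F : Measure ℝ) (G : SimpleGraph V) : Measure (G.edgeSet → ℝ) :=
  Measure.infinitePi (fun _ : G.edgeSet => F)

/-- The indicator of the event that `e` is in the maximum weight matching of `H`. -/
noncomputable def mwmInd (H : G.Subgraph) (w : G.edgeSet → ℝ) (e : G.edgeSet) : ℝ :=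
  (mwm H w).indicator (fun _ => (1 : ℝ)) e

/-! ### Correlation decay -/

/-- The subgraph of `G` induced by the vertices at distance at most `r` from an endpoint of `e`. -/
def edgeBall (e : G.edgeSet) (r : ℕ) : G.Subgraph :=
  (⊤ : G.Subgraph).induce {x | ∃ u ∈ (e : Sym2 V), G.edist u x ≤ r}

/-- The vertex boundary of a subgraph `H` of `G`. -/
def vertexBoundary (H : G.Subgraph) : Set V :=
  {v | v ∈ H.verts ∧ ∃ u, u ∉ H.verts ∧ G.Adj v u}

/-- `ϱ_r(G, e)`, the expected maximal influence on `e` of deleting boundary vertices of the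
`r`-ball around `e`. -/
noncomputable def corr (F : Measure ℝ) (G : SimpleGraph V) (e : G.edgeSet) (r : ℕ) : ℝ :=
  ∫ w, (⨆ A : {A : Set V // A ⊆ vertexBoundary (edgeBall e r)},
    |mwmInd (edgeBall e r) w e - mwmInd ((edgeBall e r).deleteVerts A.1) w e|) ∂(weightLaw F G)

def CorrelationDecay (F : Measure ℝ) (G : SimpleGraph V) : Prop :=
  ∀ e : G.edgeSet, Tendsto (fun r : ℕ => corr F G e r) atTop (𝓝 0)

/-! ### The maximum weight matching of an infinite graph -/

/-- A sequence of finite subgraphs which increases to `G`. -/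
structure IsExhaustion (H : ℕ → G.Subgraph) : Prop where
  finite : ∀ n, (H n).verts.Finite
  mono : Monotone H
  iSup_eq : ⨆ n, H n = ⊤

/-- The maximum weight matching of `G` constructed along the exhaustion `H`:
the set of edges `e` such that `1{e ∈ mwm (H n)}` tends to `1`. -/
def limitMWM (H : ℕ → G.Subgraph) (w : G.edgeSet → ℝ) : Set G.edgeSet :=
  {e | Tendsto (fun n => mwmInd (H n) w e) atTop (𝓝 1)}

end Matching

/-! ### Rooted graphs and the local metric -/

/-- A connected, locally finite rooted graph. (Such a graph is countable, so that the universe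
`Type` holds a copy of every one of them.) -/
structure RootedGraph where
  V : Type
  graph : SimpleGraph V
  root : V
  locallyFinite : ∀ v, (graph.neighborSet v).Finite
  connected : graph.Connected

namespace RootedGraph

/-- The vertices at distance at most `r` from the root. -/
def ball (g : RootedGraph) (r : ℕ) : Set g.V := {v | g.graph.edist g.root v ≤ r}

theorem root_mem_ball (g : RootedGraph) (r : ℕ) : g.root ∈ g.ball r := by
  simp [ball]

/-- The `r`-balls around the roots, as induced rooted subgraphs, are isomorphic. -/
def BallIso (g₁ g₂ : RootedGraph) (r : ℕ) : Prop :=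
  ∃ φ : g₁.graph.induce (g₁.ball r) ≃g g₂.graph.induce (g₂.ball r),
    φ ⟨g₁.root, g₁.root_mem_ball r⟩ = ⟨g₂.root, g₂.root_mem_ball r⟩

/-- The supremum of the radii `r` for which the `r`-balls are isomorphic. -/
noncomputable def agreeRadius (g₁ g₂ : RootedGraph) : ℕ∞ :=
  ⨆ r ∈ {r : ℕ | BallIso g₁ g₂ r}, (r : ℕ∞)

/-- The local distance `1 / (R + 1)` (which is `0` if `R = ∞`). -/
noncomputable def locDist (g₁ g₂ : RootedGraph) : ℝ :=
  (((agreeRadius g₁ g₂ : ℕ∞) : ENNReal) + 1)⁻¹.toReal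

theorem BallIso.refl (g : RootedGraph) (r : ℕ) : BallIso g g r :=
  ⟨SimpleGraph.Iso.refl, rfl⟩

theorem BallIso.symm {g₁ g₂ : RootedGraph} {r : ℕ} (h : BallIso g₁ g₂ r) : BallIso g₂ g₁ r := by
  obtain ⟨φ, hφ⟩ := h
  exact ⟨φ.symm, by rw [← hφ]; simp⟩

theorem BallIso.trans {g₁ g₂ g₃ : RootedGraph} {r : ℕ} (h : BallIso g₁ g₂ r)
    (h' : BallIso g₂ g₃ r) : BallIso g₁ g₃ r := by
  obtain ⟨φ, hφ⟩ := h
  obtain ⟨ψ, hψ⟩ := h'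
  exact ⟨φ.trans ψ, (congrArg ψ hφ).trans hψ⟩

theorem ball_map {g₁ g₂ : RootedGraph} {r R : ℕ} (hr : r ≤ R)
    (φ : g₁.graph.induce (g₁.ball R) ≃g g₂.graph.induce (g₂.ball R))
    (hφ : φ ⟨g₁.root, g₁.root_mem_ball R⟩ = ⟨g₂.root, g₂.root_mem_ball R⟩)
    (x : g₁.ball R) (hx : (x : g₁.V) ∈ g₁.ball r) : (φ x : g₂.V) ∈ g₂.ball r := by
  obtain ⟨p, hp⟩ := (g₁.connected.preconnected g₁.root x).exists_walk_length_eq_edist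
  have hxr : (p.length : ℕ∞) ≤ r := by rw [hp]; exact hx
  have hs : ∀ u ∈ p.support, u ∈ g₁.ball R := by
    classical
    intro u hu
    have h1 : g₁.graph.edist g₁.root u ≤ (p.takeUntil u hu).length := SimpleGraph.edist_le _
    have h2 : (p.takeUntil u hu).length ≤ p.length := p.length_takeUntil_le_length hu
    have h3 : p.length ≤ r := by exact_mod_cast hxr
    refine h1.trans ?_
    exact_mod_cast h2.trans (h3.trans hr)
  have hq : (p.induce (g₁.ball R) hs).length = p.length :=
    (SimpleGraph.Walk.length_map
      (SimpleGraph.Embedding.induce (G := g₁.graph) (g₁.ball R)).toHom _).symm.trans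
      (congrArg SimpleGraph.Walk.length (SimpleGraph.Walk.map_induce p hs))
  have h4 := SimpleGraph.edist_le ((p.induce (g₁.ball R) hs).map
    ((SimpleGraph.Embedding.induce (G := g₂.graph) (g₂.ball R)).toHom.comp φ.toHom))
  have h5 : ((SimpleGraph.Embedding.induce (G := g₂.graph) (g₂.ball R)).toHom.comp φ.toHom)
      ⟨g₁.root, hs _ p.start_mem_support⟩ = g₂.root := congrArg Subtype.val hφ
  rw [SimpleGraph.Walk.length_map, hq, h5] at h4
  exact h4.trans hxr

theorem BallIso.anti {g₁ g₂ : RootedGraph} {r R : ℕ} (hr : r ≤ R) (h : BallIso g₁ g₂ R) :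
    BallIso g₁ g₂ r := by
  obtain ⟨φ, hφ⟩ := h
  have hs : φ.symm ⟨g₂.root, g₂.root_mem_ball R⟩ = ⟨g₁.root, g₁.root_mem_ball R⟩ := by
    rw [← hφ]; simp
  have sub₁ : g₁.ball r ⊆ g₁.ball R := fun x hx =>
    le_trans (show g₁.graph.edist g₁.root x ≤ r from hx) (by exact_mod_cast hr)
  have sub₂ : g₂.ball r ⊆ g₂.ball R := fun x hx =>
    le_trans (show g₂.graph.edist g₂.root x ≤ r from hx) (by exact_mod_cast hr)
  refine ⟨⟨⟨fun x => ⟨φ ⟨x.1, sub₁ x.2⟩, ball_map hr φ hφ _ x.2⟩,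
    fun y => ⟨φ.symm ⟨y.1, sub₂ y.2⟩, ball_map hr φ.symm hs _ y.2⟩, ?_, ?_⟩, ?_⟩, ?_⟩
  · intro x
    simp
  · intro y
    simp
  · intro a b
    exact φ.map_rel_iff (a := ⟨a.1, sub₁ a.2⟩) (b := ⟨b.1, sub₁ b.2⟩)
  · have h : (φ ⟨g₁.root, g₁.root_mem_ball R⟩ : g₂.V) = g₂.root := congrArg Subtype.val hφ
    exact Subtype.ext h

theorem le_agreeRadius {g₁ g₂ : RootedGraph} {r : ℕ} (h : BallIso g₁ g₂ r) :
    (r : ℕ∞) ≤ agreeRadius g₁ g₂ :=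
  le_iSup₂ (f := fun (r : ℕ) (_ : r ∈ {r : ℕ | BallIso g₁ g₂ r}) => (r : ℕ∞)) r h

theorem ballIso_zero (g₁ g₂ : RootedGraph) : BallIso g₁ g₂ 0 := by
  have h : ∀ (g : RootedGraph) (x : g.ball 0), (x : g.V) = g.root := by
    intro g x
    have := x.2
    simp only [ball, Set.mem_ofPred_eq, Nat.cast_zero, nonpos_iff_eq_zero,
      SimpleGraph.edist_eq_zero_iff] at this
    exact this.symm
  refine ⟨⟨⟨fun _ => ⟨g₂.root, g₂.root_mem_ball 0⟩, fun _ => ⟨g₁.root, g₁.root_mem_ball 0⟩,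
    fun x => Subtype.ext (h _ x).symm, fun x => Subtype.ext (h _ x).symm⟩, ?_⟩, rfl⟩
  intro a b
  simp [h _ a, h _ b]

theorem ballIso_of_le {g₁ g₂ : RootedGraph} {r : ℕ} (h : (r : ℕ∞) ≤ agreeRadius g₁ g₂) :
    BallIso g₁ g₂ r := by
  rcases r with _ | m
  · exact ballIso_zero g₁ g₂
  · have h0 : ((m : ℕ) : ℕ∞) < agreeRadius g₁ g₂ :=
      lt_of_lt_of_le (by exact_mod_cast Nat.lt_succ_self m) h
    unfold agreeRadius at h0
    simp only [lt_iSup_iff] at h0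
    obtain ⟨s, hs, hrs⟩ := h0
    exact BallIso.anti (Nat.succ_le_of_lt (by exact_mod_cast hrs)) hs

theorem min_agreeRadius_le (g₁ g₂ g₃ : RootedGraph) :
    min (agreeRadius g₁ g₂) (agreeRadius g₂ g₃) ≤ agreeRadius g₁ g₃ := by
  rw [← ENat.forall_natCast_le_iff_le]
  intro n hn
  exact le_agreeRadius ((ballIso_of_le (hn.trans (min_le_left _ _))).trans
    (ballIso_of_le (hn.trans (min_le_right _ _))))

theorem locDist_anti {g₁ g₂ g₃ g₄ : RootedGraph} (h : agreeRadius g₁ g₂ ≤ agreeRadius g₃ g₄) :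
    locDist g₃ g₄ ≤ locDist g₁ g₂ := by
  unfold locDist
  apply ENNReal.toReal_mono
  · simp
  · apply ENNReal.inv_le_inv.mpr
    gcongr

theorem locDist_nonneg (g₁ g₂ : RootedGraph) : 0 ≤ locDist g₁ g₂ := ENNReal.toReal_nonneg

/-- Two rooted graphs are at distance `0` if and only if all their balls are isomorphic, that is (by
local finiteness) if and only if they are isomorphic. So the bounded continuous functions, the Borel
sets and the Borel measures of this space are those of the metric space of isomorphism classes. -/
noncomputable instance : PseudoMetricSpace RootedGraph where
  dist := locDist
  dist_self g := by
    have h : agreeRadius g g = ⊤ := by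
      rw [← top_le_iff, ← ENat.forall_natCast_le_iff_le]
      intro n _
      exact le_agreeRadius (BallIso.refl g n)
    change locDist g g = 0
    simp [locDist, h]
  dist_comm g₁ g₂ := by
    have h : agreeRadius g₁ g₂ = agreeRadius g₂ g₁ := by
      have hs : {r : ℕ | BallIso g₁ g₂ r} = {r : ℕ | BallIso g₂ g₁ r} :=
        Set.ext fun r => ⟨BallIso.symm, BallIso.symm⟩
      unfold agreeRadius
      rw [hs]
    change locDist g₁ g₂ = locDist g₂ g₁
    simp [locDist, h]
  dist_triangle g₁ g₂ g₃ := by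
    have h := min_agreeRadius_le g₁ g₂ g₃
    rcases min_le_iff.mp h with h | h
    · linarith [locDist_anti h, locDist_nonneg g₂ g₃]
    · linarith [locDist_anti h, locDist_nonneg g₁ g₂]

noncomputable instance : MeasurableSpace RootedGraph := borel RootedGraph

instance : BorelSpace RootedGraph := ⟨rfl⟩

/-- The sum over the neighbours `v` of the root `o` of `w (ov) 1{(ov) ∈ M}`. -/
noncomputable def rootWeight (g : RootedGraph) (M : Set g.graph.edgeSet)
    (w : g.graph.edgeSet → ℝ) : ℝ :=
  ∑ᶠ v : g.graph.neighborSet g.root,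
    M.indicator w ⟨s(g.root, (v : g.V)), (SimpleGraph.mem_edgeSet _).mpr v.2⟩

/-- The sum over the neighbours `v` of the root `o` of `1{(ov) ∈ M}`. -/
noncomputable def rootCount (g : RootedGraph) (M : Set g.graph.edgeSet) : ℝ :=
  rootWeight g M (fun _ => 1)

end RootedGraph

/-! ### Finite random graphs and local weak convergence -/

/-- A finite graph with vertex set `{0, …, k}`. A finite random graph is described by its law, a
probability measure on this countable discrete space. -/
structure FiniteGraph where
  k : ℕ
  graph : SimpleGraph (Fin (k + 1))

namespace FiniteGraph

instance : MeasurableSpace FiniteGraph := ⊤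

/-- The number of vertices. -/
def numVerts (G : FiniteGraph) : ℕ := G.k + 1

/-- The number of edges. -/
noncomputable def numEdges (G : FiniteGraph) : ℕ := G.graph.edgeSet.ncard

/-- The connected component of `o`, rooted at `o`. -/
def rootedAt (G : FiniteGraph) (o : Fin (G.k + 1)) : RootedGraph where
  V := (G.graph.connectedComponentMk o).supp
  graph := G.graph.induce (G.graph.connectedComponentMk o).supp
  root := ⟨o, rfl⟩
  locallyFinite _ := Set.toFinite _
  connected := (G.graph.connectedComponentMk o).connected_toSimpleGraph

/-- The weight of the maximum weight matching. -/
noncomputable def maxWeight (G : FiniteGraph) (w : G.graph.edgeSet → ℝ) : ℝ :=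
  ∑ᶠ e : G.graph.edgeSet, (mwm ⊤ w).indicator w e

/-- The number of edges of the maximum weight matching. -/
noncomputable def matchingSize (G : FiniteGraph) (w : G.graph.edgeSet → ℝ) : ℕ :=
  (mwm (⊤ : G.graph.Subgraph) w).ncard

end FiniteGraph

/-- `(G_n, o_n)`, with `G_n` of law `ν n` and `o_n` uniform on the vertices of `G_n`, converges
locally weakly to the random rooted graph of law `μ`. -/
def LocalWeakConvergence (ν : ℕ → Measure FiniteGraph) (μ : Measure RootedGraph) : Prop :=
  ∀ h : BoundedContinuousFunction RootedGraph ℝ,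
    Tendsto (fun n => ∫ G, (∑ o, h (G.rootedAt o)) / (G.numVerts : ℝ) ∂(ν n)) atTop
      (𝓝 (∫ g, h g ∂μ))

/-! ### Expectations over the graph and the weights -/

section Expectation

variable {α : Type*} [MeasurableSpace α] {β : α → Type*} [∀ a, MeasurableSpace (β a)]

/-- The expectation of `X (G, w)`, where `G` has law `ν` and `w` has law `κ G` given `G`. -/
noncomputable def expect (ν : Measure α) (κ : ∀ a, Measure (β a)) (X : ∀ a, β a → ℝ) : ℝ :=
  ∫ a, ∫ b, X a b ∂(κ a) ∂ν

/-- Integrability of an almost surely nonnegative random variable `X (G, w)`, where `G` has law `ν`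
and `w` has law `κ G` given `G`. -/
def FiniteExpect (ν : Measure α) (κ : ∀ a, Measure (β a)) (X : ∀ a, β a → ℝ) : Prop :=
  (∀ᵐ a ∂ν, 0 ≤ᵐ[κ a] X a ∧ Integrable (X a) (κ a)) ∧ Integrable (fun a => ∫ b, X a b ∂(κ a)) ν

end Expectation

end MaxMatching

open MaxMatching

open ProbabilityTheory BoundedContinuousFunction

/-! Counting each edge from both endpoints, the weight and the size of the maximum matching, divided
by the number of vertices, are half the average over a uniform root of a sum over the matched edges
at that root. So the expected root contribution `value` must be shown to pass to the local limit,
although membership in the matching depends on the whole graph.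

Correlation decay makes it nearly local. By exchange, a maximum matching cut along a ball is a
maximum matching of the ball minus the boundary vertices matched outwards (`IsMWM.restrict`).
Atomless weights make maximum matchings unique, so the status of `e` in any finite subgraph
containing its `r`-ball differs from its status in the ball by at most `influence e r`
(`Generic.abs_mwmInd_sub_le`); `Generic.abs_limitInd_sub_le` gives the same for the limit along any
exhaustion. For a bounded function `ψ` of the weights, `value` is hence within a multiple of
`rootCorr` of `localValue`. Both depend only on a ball around the root, so they are continuous for
the local metric (`RootedGraph.eq_of_ballIso`). Decay is assumed for the limit graph only, but the
error is itself local: capped by a constant, it is a test function, and local weak convergence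
carries its smallness to the finite graphs at each fixed radius
(`tendsto_integral_of_local_approx`).

Integrable `ψ` are reached by truncation (`tendsto_value`). The cost is at most the L¹ error times
the mean degree, which is bounded uniformly in `n` by the edge density assumption, and in the limit
by Fatou's lemma (`integrable_rootDegree`). -/

namespace MaxMatching

/-! ### Generic weights, uniqueness of the maximum matching, influence of a boundary -/

section Generic

variable {V : Type} {G : SimpleGraph V}

/-- Weights for which distinct finite sets of edges have distinct total weights. -/
def Generic (w : G.edgeSet → ℝ) : Prop :=
  ∀ M M' : Finset G.edgeSet, ∑ e ∈ M, w e = ∑ e ∈ M', w e → M = M'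

instance weightLaw_isProbabilityMeasure (F : Measure ℝ) [IsProbabilityMeasure F] :
    IsProbabilityMeasure (weightLaw F G) := by
  unfold weightLaw; infer_instance

/-- `w e` is independent of the finitely many weights in `T`, so the pair of both sides has a
product law; by Fubini the diagonal is null, since `F` has no atoms. -/
theorem ae_weight_ne (F : Measure ℝ) [IsProbabilityMeasure F] [NullSingletonClass F]
    (e : G.edgeSet) (T : Finset G.edgeSet) (he : e ∉ T) (S : (T → ℝ) → ℝ) (hS : Measurable S) :
    ∀ᵐ w ∂(weightLaw F G), w e ≠ S (fun i => w i) := by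
  have hind : iIndepFun (fun (i : G.edgeSet) (w : G.edgeSet → ℝ) => w i) (weightLaw F G) :=
    iIndepFun_infinitePi (X := fun _ x => x) (fun _ => measurable_id)
  have h1 := hind.indepFun_finset {e} T (by simpa using he) (fun i => measurable_pi_apply i)
  have hφ : Measurable (fun x : (({e} : Finset G.edgeSet) → ℝ) => x ⟨e, by simp⟩) :=
    measurable_pi_apply _
  have h2 := h1.comp hφ hS
  have hm1 : Measurable (fun w : G.edgeSet → ℝ => w e) := measurable_pi_apply e
  have hm2 : Measurable (fun w : G.edgeSet → ℝ => S (fun i => w i)) :=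
    hS.comp (measurable_pi_lambda _ fun i => measurable_pi_apply _)
  have h3 := (indepFun_iff_map_prod_eq_prod_map_map hm1.aemeasurable hm2.aemeasurable).mp h2
  have hF : (weightLaw F G).map (fun w => w e) = F := Measure.infinitePi_map_eval _ e
  rw [hF] at h3
  have hd : MeasurableSet {q : ℝ × ℝ | q.1 = q.2} :=
    measurableSet_eq_fun measurable_fst measurable_snd
  have : IsProbabilityMeasure ((weightLaw F G).map (fun w : G.edgeSet → ℝ => S (fun i => w i))) :=
    Measure.isProbabilityMeasure_map hm2.aemeasurable
  have h4 : (F.prod ((weightLaw F G).map (fun w : G.edgeSet → ℝ => S (fun i => w i))))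
      {q : ℝ × ℝ | q.1 = q.2} = 0 := by
    rw [Measure.prod_apply_symm hd]
    have : ∀ y : ℝ, (fun x => (x, y)) ⁻¹' {q : ℝ × ℝ | q.1 = q.2} = {y} := by
      intro y; ext x; simp
    simp [this]
  rw [← h3, Measure.map_apply (hm1.prodMk hm2) hd] at h4
  rw [ae_iff]
  simpa using h4

/-- Solve the equation for `w e`, which occurs on one side only: it would be a function of the other
weights involved. -/
theorem ae_sum_ne (F : Measure ℝ) [IsProbabilityMeasure F] [NullSingletonClass F]
    (M M' : Finset G.edgeSet) (e : G.edgeSet) (he : e ∈ M) (he' : e ∉ M') :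
    ∀ᵐ w ∂(weightLaw F G), ∑ i ∈ M, w i ≠ ∑ i ∈ M', w i := by
  classical
  set T := M' ∪ M.erase e
  have h := ae_weight_ne F e T (by simp [T, he'])
    (fun x => ∑ i ∈ M'.attach, x ⟨i, Finset.mem_union_left _ i.2⟩ -
      ∑ i ∈ (M.erase e).attach, x ⟨i, Finset.mem_union_right _ i.2⟩) (by fun_prop)
  filter_upwards [h] with w hw heq
  apply hw
  rw [Finset.sum_attach M' (fun i => w i), Finset.sum_attach (M.erase e) (fun i => w i), ← heq,
    ← Finset.add_sum_erase M w he]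
  ring

/-- There are only countably many pairs of finite edge sets, and two distinct sets differ by an edge
lying in exactly one of them. -/
theorem ae_generic (F : Measure ℝ) [IsProbabilityMeasure F] [NullSingletonClass F]
    [Countable V] : ∀ᵐ w ∂(weightLaw F G), Generic w := by
  unfold Generic
  rw [ae_all_iff]; intro M
  rw [ae_all_iff]; intro M'
  by_cases h : M = M'
  · simp [h]
  · by_cases hs : M ⊆ M'
    · have : ¬ M' ⊆ M := fun h' => h (hs.antisymm h')
      obtain ⟨e, he, he'⟩ := Finset.not_subset.mp this
      filter_upwards [ae_sum_ne F M' M e he he'] with w hw heq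
      exact absurd heq.symm hw
    · obtain ⟨e, he, he'⟩ := Finset.not_subset.mp hs
      filter_upwards [ae_sum_ne F M M' e he he'] with w hw heq
      exact absurd heq hw

theorem exists_isMWM (H : G.Subgraph) (hH : {e : G.edgeSet | (e : Sym2 V) ∈ H.edgeSet}.Finite)
    (w : G.edgeSet → ℝ) : ∃ M, IsMWM H w M := by
  classical
  set C : Finset (Finset G.edgeSet) := hH.toFinset.powerset.filter IsMatching
  have hC : ∀ M, M ∈ C ↔ (∀ e ∈ M, (e : Sym2 V) ∈ H.edgeSet) ∧ IsMatching M := by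
    intro M
    simp [C, Finset.subset_iff]
  have hne : C.Nonempty := ⟨∅, (hC _).2 ⟨by simp, by simp [IsMatching]⟩⟩
  obtain ⟨M, hM, hmax⟩ := C.exists_max_image (fun M => ∑ e ∈ M, w e) hne
  obtain ⟨h1, h2⟩ := (hC _).1 hM
  exact ⟨M, h1, h2, fun M' h1' h2' => hmax M' ((hC _).2 ⟨h1', h2'⟩)⟩

theorem Generic.mwm_eq {H : G.Subgraph} {w : G.edgeSet → ℝ} (hw : Generic w)
    {M : Finset G.edgeSet} (hM : IsMWM H w M) : mwm H w = (M : Set G.edgeSet) :=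
  MaxMatching.mwm_eq H w M hM fun _ hM' => hw _ _
    (le_antisymm (hM.maximal _ hM'.subset hM'.isMatching)
      (hM'.maximal _ hM.subset hM.isMatching))

theorem mwm_subset_isMWM {H : G.Subgraph} {w : G.edgeSet → ℝ} {M : Finset G.edgeSet}
    (hM : IsMWM H w M) : mwm H w ⊆ M := fun _ he => he M hM

open Classical in
theorem mwmInd_eq (H : G.Subgraph) (w : G.edgeSet → ℝ) (e : G.edgeSet) :
    mwmInd H w e = if e ∈ mwm H w then 1 else 0 := by
  simp [mwmInd, Set.indicator_apply]

theorem mwmInd_eq_zero_or_one (H : G.Subgraph) (w : G.edgeSet → ℝ) (e : G.edgeSet) :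
    mwmInd H w e = 0 ∨ mwmInd H w e = 1 := by
  rw [mwmInd_eq]; split_ifs <;> simp

/-- There are countably many finite edge sets, so the event is a countable combination of
comparisons between finite sums of weights. -/
theorem measurable_mwmInd [Countable V] (H : G.Subgraph) (e : G.edgeSet) :
    Measurable (fun w => mwmInd H w e) := by
  classical
  simp_rw [mwmInd_eq]
  refine Measurable.ite ?_ measurable_const measurable_const
  have hM : ∀ M : Finset G.edgeSet, MeasurableSet {w : G.edgeSet → ℝ | IsMWM H w M} := by
    intro M
    have : {w : G.edgeSet → ℝ | IsMWM H w M} =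
        {w | (∀ e ∈ M, (e : Sym2 V) ∈ H.edgeSet) ∧ IsMatching M} ∩ ⋂ M' : Finset G.edgeSet,
          {w | (∀ e ∈ M', (e : Sym2 V) ∈ H.edgeSet) → IsMatching M' →
            ∑ e ∈ M', w e ≤ ∑ e ∈ M, w e} := by
      ext w
      simp only [Set.mem_inter_iff, Set.mem_iInter, Set.mem_ofPred_eq]
      exact ⟨fun h => ⟨⟨h.1, h.2⟩, h.3⟩, fun h => ⟨h.1.1, h.1.2, h.2⟩⟩
    rw [this]
    refine (MeasurableSet.const _).inter (MeasurableSet.iInter fun M' => ?_)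
    by_cases h1 : ∀ e ∈ M', (e : Sym2 V) ∈ H.edgeSet
    · by_cases h2 : IsMatching M'
      · have : {w : G.edgeSet → ℝ | (∀ e ∈ M', (e : Sym2 V) ∈ H.edgeSet) → IsMatching M' →
            ∑ e ∈ M', w e ≤ ∑ e ∈ M, w e} = {w | ∑ e ∈ M', w e ≤ ∑ e ∈ M, w e} :=
          Set.ext fun w => ⟨fun h => h h1 h2, fun h _ _ => h⟩
        rw [this]
        exact measurableSet_le (by fun_prop) (by fun_prop)
      · simp [h2]
    · simp only [h1, false_imp_iff, Set.ofPred_true, MeasurableSet.univ]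
  have : {w : G.edgeSet → ℝ | e ∈ mwm H w} =
      ⋂ M : Finset G.edgeSet, {w : G.edgeSet → ℝ | IsMWM H w M → e ∈ M} := by
    ext w; simp [mwm]
  rw [this]
  refine MeasurableSet.iInter fun M => ?_
  by_cases he : e ∈ M
  · simp [he]
  · have h : {w : G.edgeSet → ℝ | IsMWM H w M → e ∈ M} = {w | IsMWM H w M}ᶜ := by
      ext w; simp [he]
    rw [h]
    exact (hM M).compl

/-- A maximum weight matching of `H` restricts to a maximum weight matching of an induced subgraph
deprived of the vertices which are matched to the outside. -/
theorem IsMWM.restrict {H : G.Subgraph} {w : G.edgeSet → ℝ} {M : Finset G.edgeSet}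
    (hM : IsMWM H w M) (S : Set V) (hSH : (⊤ : G.Subgraph).induce S ≤ H) :
    ∃ A ⊆ vertexBoundary ((⊤ : G.Subgraph).induce S), ∃ M' : Finset G.edgeSet,
      IsMWM (((⊤ : G.Subgraph).induce S).deleteVerts A) w M' ∧
      ∀ e : G.edgeSet, (e : Sym2 V) ∈ ((⊤ : G.Subgraph).induce S).edgeSet → (e ∈ M' ↔ e ∈ M) := by
  classical
  set B := (⊤ : G.Subgraph).induce S
  -- The vertices of `S` matched by `M` along an edge leaving `B`; as `B` is induced, the other
  -- endpoint is outside `S`, which puts them on the boundary.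
  set A : Set V := {v | v ∈ S ∧ ∃ f ∈ M, v ∈ (f : Sym2 V) ∧ (f : Sym2 V) ∉ B.edgeSet}
  have hA : A ⊆ vertexBoundary B := by
    rintro v ⟨hv, ⟨f, hf⟩, hfM, hvf, hfB⟩
    obtain ⟨u, rfl⟩ := Sym2.mem_iff_exists.mp hvf
    refine ⟨hv, u, fun hu => hfB ?_, hf⟩
    exact ⟨hv, hu, hf⟩
  have hAe : ∀ f : G.edgeSet, (f : Sym2 V) ∈ (B.deleteVerts A).edgeSet ↔
      (f : Sym2 V) ∈ B.edgeSet ∧ ∀ v ∈ (f : Sym2 V), v ∉ A := by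
    rintro ⟨f, hf⟩
    induction f using Sym2.ind with
    | _ a b =>
      simp only [SimpleGraph.Subgraph.mem_edgeSet, SimpleGraph.Subgraph.deleteVerts_adj,
        Sym2.mem_iff, forall_eq_or_imp, forall_eq]
      constructor
      · rintro ⟨-, h1, -, h2, h3⟩
        exact ⟨h3, h1, h2⟩
      · rintro ⟨h3, h1, h2⟩
        exact ⟨h3.fst_mem, h1, h3.snd_mem, h2, h3⟩
  have hBS : ∀ f ∈ B.edgeSet, ∀ v ∈ f, v ∈ S := fun f hf v hv =>
    SimpleGraph.Subgraph.mem_verts_of_mem_edge hf hv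
  refine ⟨A, hA, M.filter (fun f => (f : Sym2 V) ∈ B.edgeSet), ⟨?_, ?_, ?_⟩, ?_⟩
  · intro f hf
    rw [Finset.mem_filter] at hf
    refine (hAe f).2 ⟨hf.2, ?_⟩
    rintro v hv ⟨-, f', hf', hvf', hfB'⟩
    refine hM.isMatching f hf.1 f' hf' ?_ v hv hvf'
    rintro rfl
    exact hfB' hf.2
  · intro f hf f' hf'
    exact hM.isMatching f (Finset.mem_filter.mp hf).1 f' (Finset.mem_filter.mp hf').1
  · intro M' h1 h2
    have hdisj : Disjoint M' (M.filter (fun f => ¬ (f : Sym2 V) ∈ B.edgeSet)) := by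
      rw [Finset.disjoint_left]
      intro f hf hf'
      exact (Finset.mem_filter.mp hf').2 ((hAe f).1 (h1 f hf)).1
    have hcross : ∀ f ∈ M', ∀ f' ∈ M, (f' : Sym2 V) ∉ B.edgeSet → ∀ v ∈ (f : Sym2 V),
        v ∉ (f' : Sym2 V) := by
      intro f hf f' hf' hfB v hv hv'
      obtain ⟨h3, h4⟩ := (hAe f).1 (h1 f hf)
      exact h4 v hv ⟨hBS _ h3 v hv, f', hf', hv', hfB⟩
    -- Exchange: a competitor `M'` avoids `A`, so the edges of `M` outside `B` complete it to a
    -- matching of `H`; comparing with `M` and cancelling these edges gives the claim.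
    have h3 := hM.maximal (M' ∪ M.filter (fun f => ¬ (f : Sym2 V) ∈ B.edgeSet)) ?_ ?_
    · rw [Finset.sum_union hdisj, ← Finset.sum_filter_add_sum_filter_not M
        (fun f => (f : Sym2 V) ∈ B.edgeSet)] at h3
      linarith
    · intro f hf
      rcases Finset.mem_union.mp hf with hf | hf
      · exact SimpleGraph.Subgraph.edgeSet_mono hSH ((hAe f).1 (h1 f hf)).1
      · exact hM.subset f (Finset.mem_filter.mp hf).1
    · intro f hf f' hf' hne v hv hv'
      rcases Finset.mem_union.mp hf with hf | hf <;> rcases Finset.mem_union.mp hf' with hf' | hf'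
      · exact h2 f hf f' hf' hne v hv hv'
      · exact hcross f hf f' (Finset.mem_filter.mp hf').1 (Finset.mem_filter.mp hf').2 v hv hv'
      · exact hcross f' hf' f (Finset.mem_filter.mp hf).1 (Finset.mem_filter.mp hf).2 v hv' hv
      · exact hM.isMatching f (Finset.mem_filter.mp hf).1 f' (Finset.mem_filter.mp hf').1 hne v hv
          hv'
  · intro e he
    simp [he]

/-- The maximal influence on `e` of deleting boundary vertices of the `r`-ball around `e`. -/
noncomputable def influence (e : G.edgeSet) (r : ℕ) (w : G.edgeSet → ℝ) : ℝ :=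
  ⨆ A : {A : Set V // A ⊆ vertexBoundary (edgeBall e r)},
    |mwmInd (edgeBall e r) w e - mwmInd ((edgeBall e r).deleteVerts A.1) w e|

theorem abs_mwmInd_sub_le_one (H H' : G.Subgraph) (w : G.edgeSet → ℝ) (e e' : G.edgeSet) :
    |mwmInd H w e - mwmInd H' w e'| ≤ 1 := by
  rcases mwmInd_eq_zero_or_one H w e with h | h <;>
    rcases mwmInd_eq_zero_or_one H' w e' with h' | h' <;> simp [h, h']

theorem le_influence (e : G.edgeSet) (r : ℕ) (w : G.edgeSet → ℝ) (A : Set V)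
    (hA : A ⊆ vertexBoundary (edgeBall e r)) :
    |mwmInd (edgeBall e r) w e - mwmInd ((edgeBall e r).deleteVerts A) w e| ≤
      influence e r w :=
  le_ciSup (f := fun A : {A : Set V // A ⊆ vertexBoundary (edgeBall e r)} =>
    |mwmInd (edgeBall e r) w e - mwmInd ((edgeBall e r).deleteVerts A.1) w e|)
    ⟨1, by rintro _ ⟨A, rfl⟩; exact abs_mwmInd_sub_le_one _ _ _ _ _⟩ ⟨A, hA⟩

theorem influence_nonneg (e : G.edgeSet) (r : ℕ) (w : G.edgeSet → ℝ) : 0 ≤ influence e r w :=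
  (abs_nonneg _).trans (le_influence e r w ∅ (Set.empty_subset _))

theorem influence_le_one (e : G.edgeSet) (r : ℕ) (w : G.edgeSet → ℝ) : influence e r w ≤ 1 := by
  have : Nonempty {A : Set V // A ⊆ vertexBoundary (edgeBall e r)} := ⟨∅, Set.empty_subset _⟩
  exact ciSup_le fun A => abs_mwmInd_sub_le_one _ _ _ _ _

theorem self_mem_edgeBall (e : G.edgeSet) (r : ℕ) : (e : Sym2 V) ∈ (edgeBall e r).edgeSet := by
  obtain ⟨e, he⟩ := e
  induction e using Sym2.ind with
  | _ a b =>
    exact ⟨⟨a, by simp, by simp⟩, ⟨b, by simp, by simp⟩, he⟩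

/-- The matching of `H` treats `e` as does the ball deprived of the boundary vertices matched
outwards, and that deletion is one of those over which the supremum in `influence` is taken. -/
theorem Generic.abs_mwmInd_sub_le {w : G.edgeSet → ℝ} (hw : Generic w) (e : G.edgeSet) (r : ℕ)
    (H : G.Subgraph) (hH : {e : G.edgeSet | (e : Sym2 V) ∈ H.edgeSet}.Finite)
    (hle : edgeBall e r ≤ H) :
    |mwmInd (edgeBall e r) w e - mwmInd H w e| ≤ influence e r w := by
  obtain ⟨M, hM⟩ := exists_isMWM H hH w
  obtain ⟨A, hA, M', hM', hiff⟩ := hM.restrict _ hle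
  have : mwmInd H w e = mwmInd ((edgeBall e r).deleteVerts A) w e := by
    classical
    rw [mwmInd_eq, mwmInd_eq, edgeBall, hw.mwm_eq hM, hw.mwm_eq hM']
    simp [hiff e (self_mem_edgeBall e r)]
  rw [this]
  exact le_influence e r w A hA

theorem measurable_influence [Countable V] (e : G.edgeSet) (r : ℕ)
    (hfin : (vertexBoundary (edgeBall e r)).Finite) : Measurable (influence e r) := by
  have : Finite {A : Set V // A ⊆ vertexBoundary (edgeBall e r)} := hfin.finite_subsets.to_subtype
  unfold influence
  refine Measurable.iSup fun A => ?_
  exact ((measurable_mwmInd _ e).sub (measurable_mwmInd _ e)).abs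

theorem corr_eq (F : Measure ℝ) (e : G.edgeSet) (r : ℕ) :
    corr F G e r = ∫ w, influence e r w ∂(weightLaw F G) := rfl

theorem corr_nonneg (F : Measure ℝ) (e : G.edgeSet) (r : ℕ) : 0 ≤ corr F G e r :=
  integral_nonneg fun w => influence_nonneg e r w

end Generic

/-! ### Finiteness of balls, and sums over the edges at the root -/

section Balls

variable {V : Type} {G : SimpleGraph V}

theorem finite_setOf_edist_le (hG : ∀ v, (G.neighborSet v).Finite) (u : V) (r : ℕ) :
    {x | G.edist u x ≤ r}.Finite := by
  induction r with
  | zero =>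
    refine (Set.finite_singleton u).subset fun x hx => ?_
    have h0 : G.edist u x ≤ 0 := hx
    exact (SimpleGraph.edist_eq_zero_iff.mp (nonpos_iff_eq_zero.mp h0)).symm
  | succ r ih =>
    refine (ih.union (ih.biUnion fun z _ => hG z)).subset fun x hx => ?_
    -- The walk is read from `x` to `u`, so that its first step gives a neighbour `z` of `x` to
    -- which the induction hypothesis applies.
    have hx' : G.edist x u ≤ ((r + 1 : ℕ) : ℕ∞) := by rw [SimpleGraph.edist_comm]; exact hx
    obtain ⟨p, hp⟩ := SimpleGraph.exists_walk_of_edist_ne_top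
      (ne_top_of_le_ne_top (ENat.natCast_ne_top _) hx')
    rw [← hp] at hx'
    cases p with
    | nil => exact Or.inl (by simp)
    | @cons _ z _ h q =>
      have hq : q.length ≤ r := by
        have : q.length + 1 ≤ r + 1 := by exact_mod_cast hx'
        omega
      refine Or.inr (Set.mem_biUnion (x := z) ?_ h.symm)
      have h1 := SimpleGraph.edist_le q
      rw [SimpleGraph.edist_comm] at h1
      exact h1.trans (by exact_mod_cast hq)

theorem finite_edgeSet_of_finite_verts (H : G.Subgraph) (hH : H.verts.Finite) :
    {e : G.edgeSet | (e : Sym2 V) ∈ H.edgeSet}.Finite := by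
  have h1 : (H.edgeSet).Finite := by
    refine ((hH.prod hH).image (fun q : V × V => s(q.1, q.2))).subset ?_
    intro e he
    induction e using Sym2.ind with
    | _ a b => exact ⟨(a, b), ⟨H.edge_vert he, H.edge_vert (H.symm.symm _ _ he)⟩, rfl⟩
  exact h1.preimage Subtype.val_injective.injOn

theorem finite_verts_edgeBall (hG : ∀ v, (G.neighborSet v).Finite) (e : G.edgeSet) (r : ℕ) :
    (edgeBall e r).verts.Finite := by
  obtain ⟨e, he⟩ := e
  induction e using Sym2.ind with
  | _ a b =>
    refine ((finite_setOf_edist_le hG a r).union (finite_setOf_edist_le hG b r)).subset ?_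
    rintro x ⟨u, hu, hx⟩
    rcases Sym2.mem_iff.mp hu with rfl | rfl
    · exact Or.inl hx
    · exact Or.inr hx

theorem finite_vertexBoundary_edgeBall (hG : ∀ v, (G.neighborSet v).Finite) (e : G.edgeSet)
    (r : ℕ) : (vertexBoundary (edgeBall e r)).Finite :=
  (finite_verts_edgeBall hG e r).subset fun _ hv => hv.1

/-- The subgraph of `G` induced by the vertices at distance at most `r` from `o`. -/
def rootBall (G : SimpleGraph V) (o : V) (r : ℕ) : G.Subgraph :=
  (⊤ : G.Subgraph).induce {x | G.edist o x ≤ r}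

theorem finite_verts_rootBall (hG : ∀ v, (G.neighborSet v).Finite) (o : V) (r : ℕ) :
    (rootBall G o r).verts.Finite := finite_setOf_edist_le hG o r

/-- The edge from `o` to a neighbour. -/
def rootEdge {o : V} (v : G.neighborSet o) : G.edgeSet :=
  ⟨s(o, (v : V)), (SimpleGraph.mem_edgeSet _).mpr v.2⟩

theorem rootEdge_injective {o : V} : Function.Injective (rootEdge (G := G) (o := o)) := by
  intro v v' h
  have := congrArg Subtype.val h
  exact Subtype.ext (Sym2.congr_right.mp this)

theorem edist_le_one_of_adj {o v : V} (h : G.Adj o v) : G.edist o v ≤ 1 :=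
  SimpleGraph.edist_le_one_iff_adj_or_eq.mpr (Or.inl h)

/-- The radius grows by one because the far endpoint of a root edge is at distance one from `o`. -/
theorem edgeBall_rootEdge_le {o : V} (v : G.neighborSet o) (r : ℕ) :
    edgeBall (rootEdge v) r ≤ rootBall G o (r + 1) := by
  refine SimpleGraph.Subgraph.induce_mono_right ?_
  rintro x ⟨u, hu, hx⟩
  have hu' : G.edist o u ≤ 1 := by
    rcases Sym2.mem_iff.mp hu with rfl | rfl
    · simp
    · exact edist_le_one_of_adj v.2
  calc G.edist o x ≤ G.edist o u + G.edist u x := SimpleGraph.edist_triangle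
    _ ≤ 1 + r := add_le_add hu' hx
    _ = ((r + 1 : ℕ) : ℕ∞) := by push_cast; ring

/-- The sum of a function of the edges over the edges incident to `o`. -/
noncomputable def rootSum (G : SimpleGraph V) (o : V) (a : G.edgeSet → ℝ) : ℝ :=
  ∑ᶠ v : G.neighborSet o, a (rootEdge v)

end Balls

/-! ### Invariance of matchings and influences under embeddings that cover a ball -/

section Transport

variable {U V : Type} {K : SimpleGraph U} {G : SimpleGraph V}

theorem coe_mapEdgeSet (ι : K ↪g G) (e : K.edgeSet) :
    (ι.mapEdgeSet e : Sym2 V) = Sym2.map ι e := rfl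

theorem mapEdgeSet_mem_map (ι : K ↪g G) (H : K.Subgraph) (e : K.edgeSet) :
    (ι.mapEdgeSet e : Sym2 V) ∈ (H.map ι.toHom).edgeSet ↔ (e : Sym2 U) ∈ H.edgeSet := by
  rw [SimpleGraph.Subgraph.edgeSet_map]
  exact (Sym2.map.injective ι.injective).mem_set_image

theorem isMatching_map (ι : K ↪g G) (M : Finset K.edgeSet) :
    IsMatching (M.map ι.mapEdgeSet) ↔ IsMatching M := by
  unfold IsMatching
  simp only [Finset.mem_map, forall_exists_index, and_imp, forall_apply_eq_imp_iff₂,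
    coe_mapEdgeSet, Sym2.mem_map, ne_eq, EmbeddingLike.apply_eq_iff_eq]
  constructor
  · intro h e he e' he' hne v hv hv'
    exact h e he e' he' hne v hv ⟨v, hv', rfl⟩
  · rintro h e he e' he' hne _ hv ⟨v, hv', rfl⟩
    exact h e he e' he' hne v hv hv'

theorem exists_eq_map (ι : K ↪g G) (H : K.Subgraph) (M : Finset G.edgeSet)
    (hM : ∀ e ∈ M, (e : Sym2 V) ∈ (H.map ι.toHom).edgeSet) :
    ∃ M' : Finset K.edgeSet, M = M'.map ι.mapEdgeSet ∧ ∀ e ∈ M', (e : Sym2 U) ∈ H.edgeSet := by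
  classical
  refine ⟨M.preimage ι.mapEdgeSet ι.mapEdgeSet.injective.injOn, ?_, ?_⟩
  · ext e
    simp only [Finset.mem_map, Finset.mem_preimage]
    constructor
    · intro he
      have h := hM e he
      rw [SimpleGraph.Subgraph.edgeSet_map] at h
      obtain ⟨e', he', h⟩ := h
      have h' : ι.mapEdgeSet ⟨e', H.edgeSet_subset he'⟩ = e := Subtype.ext h
      exact ⟨⟨e', H.edgeSet_subset he'⟩, h' ▸ he, h'⟩
    · rintro ⟨e', he', rfl⟩
      exact he'
  · intro e he
    rw [Finset.mem_preimage] at he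
    exact (mapEdgeSet_mem_map ι H e).1 (hM _ he)

theorem isMWM_map (ι : K ↪g G) (H : K.Subgraph) (w : G.edgeSet → ℝ) (M : Finset K.edgeSet) :
    IsMWM (H.map ι.toHom) w (M.map ι.mapEdgeSet) ↔ IsMWM H (w ∘ ι.mapEdgeSet) M := by
  constructor
  · intro h
    refine ⟨fun e he => (mapEdgeSet_mem_map ι H e).1 (h.subset _ (Finset.mem_map_of_mem _ he)),
      (isMatching_map ι M).1 h.isMatching, fun M' h1 h2 => ?_⟩
    have := h.maximal (M'.map ι.mapEdgeSet) ?_ ((isMatching_map ι M').2 h2)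
    · simpa using this
    · intro e he
      obtain ⟨e', he', rfl⟩ := Finset.mem_map.mp he
      exact (mapEdgeSet_mem_map ι H e').2 (h1 e' he')
  · intro h
    refine ⟨fun e he => ?_, (isMatching_map ι M).2 h.isMatching, fun M' h1 h2 => ?_⟩
    · obtain ⟨e', he', rfl⟩ := Finset.mem_map.mp he
      exact (mapEdgeSet_mem_map ι H e').2 (h.subset e' he')
    · obtain ⟨M'', rfl, h3⟩ := exists_eq_map ι H M' h1
      simpa using h.maximal M'' h3 ((isMatching_map ι M'').1 h2)

/-- Only the weights of edges in the image matter, and the maximum matchings of the image subgraph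
are exactly the images of those of `H`. -/
theorem mwmInd_map (ι : K ↪g G) (H : K.Subgraph) (w : G.edgeSet → ℝ) (e : K.edgeSet) :
    mwmInd (H.map ι.toHom) w (ι.mapEdgeSet e) = mwmInd H (w ∘ ι.mapEdgeSet) e := by
  classical
  rw [mwmInd_eq, mwmInd_eq]
  congr 1
  rw [eq_iff_iff]
  constructor
  · intro h M hM
    exact (Finset.mem_map' _).mp (h _ ((isMWM_map ι H w M).2 hM))
  · intro h M hM
    obtain ⟨M', rfl, -⟩ := exists_eq_map ι H M hM.subset
    exact Finset.mem_map_of_mem _ (h M' ((isMWM_map ι H w M').1 hM))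

/-- Restricting an i.i.d. family along an injection of index sets gives an i.i.d. family with the
same marginal. -/
theorem map_weightLaw (F : Measure ℝ) [IsProbabilityMeasure F] (ι : K ↪g G) :
    (weightLaw F G).map (fun w => w ∘ ι.mapEdgeSet) = weightLaw F K :=
  Measure.map_infinitePi_infinitePi_of_inj (P := fun _ : G.edgeSet => F) ι.mapEdgeSet.injective

theorem integral_comp_mapEdgeSet (F : Measure ℝ) [IsProbabilityMeasure F] (ι : K ↪g G)
    (Φ : (K.edgeSet → ℝ) → ℝ) (hΦ : Measurable Φ) :
    ∫ w, Φ (w ∘ ι.mapEdgeSet) ∂(weightLaw F G) = ∫ w, Φ w ∂(weightLaw F K) := by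
  rw [← map_weightLaw F ι, integral_map]
  · exact Measurable.aemeasurable (measurable_pi_lambda _ fun i => measurable_pi_apply _)
  · exact hΦ.aestronglyMeasurable

/-- The embedding `ι` covers the ball of radius `n` around `ι u`. -/
def Covers (ι : K ↪g G) (u : U) (n : ℕ) : Prop := ∀ x, G.edist (ι u) x ≤ n → x ∈ Set.range ι

theorem Covers.mono {ι : K ↪g G} {u : U} {n m : ℕ} (h : Covers ι u n) (hmn : m ≤ n) :
    Covers ι u m := fun x hx => h x (hx.trans (by exact_mod_cast hmn))

theorem edist_map_le (ι : K ↪g G) (u y : U) : G.edist (ι u) (ι y) ≤ K.edist u y := by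
  by_cases h : K.edist u y = ⊤
  · simp [h]
  · obtain ⟨p, hp⟩ := SimpleGraph.exists_walk_of_edist_ne_top h
    rw [← hp]
    simpa using SimpleGraph.edist_le (p.map ι.toHom)

theorem Covers.of_adj {ι : K ↪g G} {u v : U} {n : ℕ} (h : Covers ι u (n + 1)) (huv : K.Adj u v) :
    Covers ι v n := by
  intro x hx
  refine h x ?_
  calc G.edist (ι u) x ≤ G.edist (ι u) (ι v) + G.edist (ι v) x := SimpleGraph.edist_triangle
    _ ≤ 1 + n := add_le_add (edist_le_one_of_adj (ι.map_rel_iff.mpr huv)) hx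
    _ = ((n + 1 : ℕ) : ℕ∞) := by push_cast; ring

/-- A walk of length at most `n` that ends at `ι u` never leaves the covered ball, so it lifts to
`K` vertex by vertex. The endpoints are variables tied by equations so that induction on the walk
applies. -/
theorem Covers.edist_le_of_walk {ι : K ↪g G} {u : U} {n : ℕ} (h : Covers ι u n) {a b : V}
    (p : G.Walk a b) : ∀ y, a = ι y → b = ι u → p.length ≤ n → K.edist y u ≤ p.length := by
  induction p with
  | nil =>
    intro y h1 h2 _
    have : y = u := ι.injective (h1.symm.trans h2)
    simp [this]
  | @cons a c b hac q ih =>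
    intro y h1 h2 hl
    subst h1 h2
    have hq : q.length ≤ n := by simp at hl; omega
    have h3 := SimpleGraph.edist_le q
    rw [SimpleGraph.edist_comm] at h3
    obtain ⟨z, rfl⟩ := h c (h3.trans (by exact_mod_cast hq))
    calc K.edist y u ≤ K.edist y z + K.edist z u := SimpleGraph.edist_triangle
      _ ≤ 1 + q.length := add_le_add (edist_le_one_of_adj (ι.map_rel_iff.mp hac))
        (ih z rfl rfl hq)
      _ = _ := by simp [add_comm]

theorem Covers.edist_le_iff {ι : K ↪g G} {u : U} {n m : ℕ} (h : Covers ι u n) (hm : m ≤ n)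
    (y : U) : G.edist (ι u) (ι y) ≤ m ↔ K.edist u y ≤ m := by
  refine ⟨fun h1 => ?_, (edist_map_le ι u y).trans⟩
  rw [SimpleGraph.edist_comm] at h1 ⊢
  obtain ⟨p, hp⟩ := SimpleGraph.exists_walk_of_edist_ne_top
    (ne_top_of_le_ne_top (ENat.natCast_ne_top _) h1)
  rw [← hp] at h1
  exact (h.edist_le_of_walk p y rfl rfl ((by exact_mod_cast h1 : p.length ≤ m).trans hm)).trans h1

theorem map_induce_top (ι : K ↪g G) (S : Set U) :
    ((⊤ : K.Subgraph).induce S).map ι.toHom = (⊤ : G.Subgraph).induce (ι '' S) := by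
  ext a b
  · rfl
  · simp only [SimpleGraph.Subgraph.map_adj, Relation.Map, SimpleGraph.Subgraph.induce_adj,
      SimpleGraph.Subgraph.top_adj]
    constructor
    · rintro ⟨x, y, ⟨hx, hy, hxy⟩, rfl, rfl⟩
      exact ⟨⟨x, hx, rfl⟩, ⟨y, hy, rfl⟩, ι.map_rel_iff.mpr hxy⟩
    · rintro ⟨⟨x, hx, rfl⟩, ⟨y, hy, rfl⟩, hxy⟩
      exact ⟨x, y, ⟨hx, hy, ι.map_rel_iff.mp hxy⟩, rfl, rfl⟩

theorem Covers.image_ball {ι : K ↪g G} {u : U} {n m : ℕ} (h : Covers ι u n) (hm : m ≤ n) :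
    ι '' {x | K.edist u x ≤ m} = {x | G.edist (ι u) x ≤ m} := by
  ext x
  constructor
  · rintro ⟨y, hy, rfl⟩
    exact (h.edist_le_iff hm y).2 hy
  · intro hx
    obtain ⟨y, rfl⟩ := h.mono hm x hx
    exact ⟨y, (h.edist_le_iff hm y).1 hx, rfl⟩

theorem Covers.map_rootBall {ι : K ↪g G} {o : U} {r : ℕ} (h : Covers ι o r) :
    (rootBall K o r).map ι.toHom = rootBall G (ι o) r := by
  rw [rootBall, map_induce_top, h.image_ball le_rfl, rootBall]

theorem image_edgeBall {ι : K ↪g G} {e : K.edgeSet} {r : ℕ}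
    (h : ∀ u ∈ (e : Sym2 U), Covers ι u r) :
    ι '' (edgeBall e r).verts = (edgeBall (ι.mapEdgeSet e) r).verts := by
  ext x
  constructor
  · rintro ⟨y, ⟨u, hu, hy⟩, rfl⟩
    exact ⟨ι u, Sym2.mem_map.mpr ⟨u, hu, rfl⟩, ((h u hu).edist_le_iff le_rfl y).2 hy⟩
  · rintro ⟨u', hu', hx⟩
    obtain ⟨u, hu, rfl⟩ := Sym2.mem_map.mp hu'
    obtain ⟨y, rfl⟩ := h u hu x hx
    exact ⟨y, ⟨u, hu, ((h u hu).edist_le_iff le_rfl y).1 hx⟩, rfl⟩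

theorem map_edgeBall {ι : K ↪g G} {e : K.edgeSet} {r : ℕ}
    (h : ∀ u ∈ (e : Sym2 U), Covers ι u r) :
    (edgeBall e r).map ι.toHom = edgeBall (ι.mapEdgeSet e) r := by
  have := image_edgeBall h
  rw [edgeBall, map_induce_top]
  exact congrArg _ this

/-- The radius is `r + 1` because a boundary vertex is recognised by a neighbour outside the
`r`-ball, which must also lie in the range of `ι`. -/
theorem image_vertexBoundary_edgeBall {ι : K ↪g G} {e : K.edgeSet} {r : ℕ}
    (h : ∀ u ∈ (e : Sym2 U), Covers ι u (r + 1)) :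
    ι '' vertexBoundary (edgeBall e r) = vertexBoundary (edgeBall (ι.mapEdgeSet e) r) := by
  have hb := image_edgeBall (fun u hu => (h u hu).mono (Nat.le_succ r))
  ext x
  simp only [vertexBoundary, ← hb]
  constructor
  · rintro ⟨y, ⟨hy, z, hz, hyz⟩, rfl⟩
    refine ⟨⟨y, hy, rfl⟩, ι z, ?_, ι.map_rel_iff.mpr hyz⟩
    rwa [ι.injective.mem_set_image]
  · rintro ⟨⟨y, hy, rfl⟩, z, hz, hyz⟩
    obtain ⟨u, hu, huy⟩ := hy
    obtain ⟨z, rfl⟩ : z ∈ Set.range ι := by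
      refine h u hu z ?_
      calc G.edist (ι u) z ≤ G.edist (ι u) (ι y) + G.edist (ι y) z := SimpleGraph.edist_triangle
        _ ≤ r + 1 := add_le_add ((edist_map_le ι u y).trans huy) (edist_le_one_of_adj hyz)
        _ = ((r + 1 : ℕ) : ℕ∞) := by push_cast; ring
    rw [ι.injective.mem_set_image] at hz
    exact ⟨y, ⟨⟨u, hu, huy⟩, z, hz, ι.map_rel_iff.mp hyz⟩, rfl⟩

theorem map_deleteVerts (ι : K ↪g G) (H : K.Subgraph) (A : Set U) :
    (H.deleteVerts A).map ι.toHom = (H.map ι.toHom).deleteVerts (ι '' A) := by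
  ext a b
  · simp only [SimpleGraph.Subgraph.map_verts, SimpleGraph.Subgraph.deleteVerts_verts]
    exact iff_of_eq (congrArg (a ∈ ·) (Set.image_sdiff ι.injective _ _))
  · simp only [SimpleGraph.Subgraph.map_adj, Relation.Map, SimpleGraph.Subgraph.deleteVerts_adj]
    constructor
    · rintro ⟨x, y, ⟨hx, hxA, hy, hyA, hxy⟩, rfl, rfl⟩
      refine ⟨⟨x, hx, rfl⟩, ?_, ⟨y, hy, rfl⟩, ?_, x, y, hxy, rfl, rfl⟩
      · exact fun hm => hxA (ι.injective.mem_set_image.mp hm)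
      · exact fun hm => hyA (ι.injective.mem_set_image.mp hm)
    · rintro ⟨-, hxA, -, hyA, x, y, hxy, rfl, rfl⟩
      exact ⟨x, y, ⟨hxy.fst_mem, fun hm => hxA ⟨x, hm, rfl⟩, hxy.snd_mem,
        fun hm => hyA ⟨y, hm, rfl⟩, hxy⟩, rfl, rfl⟩

/-- Taking images under `ι` matches the admissible sets `A` on both sides, and deletion of vertices
commutes with `ι`. -/
theorem influence_map {ι : K ↪g G} {e : K.edgeSet} {r : ℕ}
    (h : ∀ u ∈ (e : Sym2 U), Covers ι u (r + 1)) (w : G.edgeSet → ℝ) :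
    influence (ι.mapEdgeSet e) r w = influence e r (w ∘ ι.mapEdgeSet) := by
  have hm := map_edgeBall (fun u hu => (h u hu).mono (Nat.le_succ r))
  have hb := image_vertexBoundary_edgeBall h
  unfold influence
  symm
  refine Function.Surjective.iSup_congr (fun A => ⟨ι '' A.1, ?_⟩) ?_ ?_
  · rw [← hb]; exact Set.image_mono A.2
  · rintro ⟨A, hA⟩
    rw [← hb] at hA
    obtain ⟨A', hA', rfl⟩ := Set.subset_image_iff.mp hA
    exact ⟨⟨A', hA'⟩, rfl⟩
  · rintro ⟨A, hA⟩
    dsimp only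
    rw [← hm, ← map_deleteVerts, mwmInd_map, mwmInd_map]

theorem corr_map (F : Measure ℝ) [IsProbabilityMeasure F] [Countable U]
    (hK : ∀ v, (K.neighborSet v).Finite) {ι : K ↪g G} {e : K.edgeSet} {r : ℕ}
    (h : ∀ u ∈ (e : Sym2 U), Covers ι u (r + 1)) :
    corr F G (ι.mapEdgeSet e) r = corr F K e r := by
  rw [corr_eq, corr_eq, ← integral_comp_mapEdgeSet F ι _
    (measurable_influence e r (finite_vertexBoundary_edgeBall hK e r))]
  simp_rw [influence_map h]

theorem rootSum_map {ι : K ↪g G} {o : U} (h : Covers ι o 1) (a : G.edgeSet → ℝ) :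
    rootSum G (ι o) a = rootSum K o (a ∘ ι.mapEdgeSet) := by
  unfold rootSum
  symm
  refine finsum_eq_of_bijective (fun v => ⟨ι v, ι.map_rel_iff.mpr v.2⟩) ⟨?_, ?_⟩ ?_
  · intro v v' hv
    exact Subtype.ext (ι.injective (congrArg Subtype.val hv))
  · rintro ⟨v, hv⟩
    obtain ⟨v, rfl⟩ := h v (by simpa using edist_le_one_of_adj hv)
    exact ⟨⟨v, ι.map_rel_iff.mp hv⟩, rfl⟩
  · intro v
    rfl

end Transport

/-! ### The expected contribution of the root and its local approximation -/

section Value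

variable {V : Type} {G : SimpleGraph V} {o : V}

theorem rootSum_eq_sum [Fintype (G.neighborSet o)] (a : G.edgeSet → ℝ) :
    rootSum G o a = ∑ v : G.neighborSet o, a (rootEdge v) :=
  finsum_eq_sum_of_fintype _

/-- The expectation of the sum of `X (ov) * ψ (w (ov))` over the neighbours `v` of `o`. -/
noncomputable def value (F : Measure ℝ) (ψ : ℝ → ℝ) (G : SimpleGraph V) (o : V)
    (X : (G.edgeSet → ℝ) → G.edgeSet → ℝ) : ℝ :=
  ∫ w, rootSum G o (fun e => X w e * ψ (w e)) ∂(weightLaw F G)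

/-- The degree of `o`. -/
noncomputable def rootDegree (G : SimpleGraph V) (o : V) : ℝ := rootSum G o fun _ => 1

theorem rootDegree_nonneg : 0 ≤ rootDegree G o := finsum_nonneg fun _ => zero_le_one

/-- The sum over the neighbours `v` of `o` of `ϱ_r(G, ov)`. -/
noncomputable def rootCorr (F : Measure ℝ) (G : SimpleGraph V) (o : V) (r : ℕ) : ℝ :=
  rootSum G o fun e => corr F G e r

theorem rootCorr_nonneg (F : Measure ℝ) (r : ℕ) : 0 ≤ rootCorr F G o r :=
  finsum_nonneg fun _ => corr_nonneg F _ r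

/-- The expected contribution of the root edges in the maximum weight matching of the `r`-ball. -/
noncomputable def localValue (F : Measure ℝ) (ψ : ℝ → ℝ) (G : SimpleGraph V) (o : V) (r : ℕ) : ℝ :=
  value F ψ G o (mwmInd (rootBall G o r))

theorem measurable_rootSum (hG : (G.neighborSet o).Finite) {ψ : ℝ → ℝ} (hψ : Measurable ψ)
    {X : (G.edgeSet → ℝ) → G.edgeSet → ℝ} (hX : ∀ e, Measurable fun w => X w e) :
    Measurable fun w => rootSum G o (fun e => X w e * ψ (w e)) := by
  have := hG.fintype
  simp_rw [rootSum_eq_sum]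
  exact Finset.measurable_sum _ fun v _ => (hX _).mul (hψ.comp (measurable_pi_apply _))

theorem integrable_weight (F : Measure ℝ) [IsProbabilityMeasure F] {ψ : ℝ → ℝ}
    (hψ : Integrable ψ F) (e : G.edgeSet) : Integrable (fun w => ψ (w e)) (weightLaw F G) :=
  (measurePreserving_eval_infinitePi (fun _ : G.edgeSet => F) e).integrable_comp_of_integrable hψ

theorem integral_weight (F : Measure ℝ) [IsProbabilityMeasure F] {ψ : ℝ → ℝ}
    (hψ : AEStronglyMeasurable ψ F) (e : G.edgeSet) :
    ∫ w, ψ (w e) ∂(weightLaw F G) = ∫ x, ψ x ∂F := by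
  have h := (measurePreserving_eval_infinitePi (fun _ : G.edgeSet => F) e)
  have h2 := integral_map (f := ψ) h.measurable.aemeasurable (by rwa [h.map_eq])
  rw [h.map_eq] at h2
  exact h2.symm

theorem ae_forall_weight_nonneg [Countable V] (F : Measure ℝ) [IsProbabilityMeasure F] {ψ : ℝ → ℝ}
    (hψ : ∀ᵐ x ∂F, 0 ≤ ψ x) : ∀ᵐ w ∂(weightLaw F G), ∀ e : G.edgeSet, 0 ≤ ψ (w e) := by
  rw [ae_all_iff]
  intro e
  exact (measurePreserving_eval_infinitePi
    (fun _ : G.edgeSet => F) e).quasiMeasurePreserving.ae hψ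

theorem integrable_mul_weight (F : Measure ℝ) [IsProbabilityMeasure F] {ψ : ℝ → ℝ}
    (hψ : Integrable ψ F) {X : (G.edgeSet → ℝ) → G.edgeSet → ℝ}
    (hX : ∀ e, Measurable fun w => X w e) (hX1 : ∀ w e, |X w e| ≤ 1) (e : G.edgeSet) :
    Integrable (fun w => X w e * ψ (w e)) (weightLaw F G) :=
  (integrable_weight F hψ e).bdd_mul (c := 1) (hX e).aestronglyMeasurable
    (Eventually.of_forall fun w => hX1 w e)

theorem integrable_rootSum (hG : (G.neighborSet o).Finite)
    (F : Measure ℝ) [IsProbabilityMeasure F] {ψ : ℝ → ℝ}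
    (hψ : Integrable ψ F) {X : (G.edgeSet → ℝ) → G.edgeSet → ℝ}
    (hX : ∀ e, Measurable fun w => X w e) (hX1 : ∀ w e, |X w e| ≤ 1) :
    Integrable (fun w => rootSum G o (fun e => X w e * ψ (w e))) (weightLaw F G) := by
  have := hG.fintype
  simp_rw [rootSum_eq_sum]
  exact integrable_finsetSum _ fun v _ => integrable_mul_weight F hψ hX hX1 _

theorem value_eq_rootSum (hG : (G.neighborSet o).Finite)
    (F : Measure ℝ) [IsProbabilityMeasure F] {ψ : ℝ → ℝ}
    (hψ : Integrable ψ F) {X : (G.edgeSet → ℝ) → G.edgeSet → ℝ}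
    (hX : ∀ e, Measurable fun w => X w e) (hX1 : ∀ w e, |X w e| ≤ 1) :
    value F ψ G o X = rootSum G o fun e => ∫ w, X w e * ψ (w e) ∂(weightLaw F G) := by
  have := hG.fintype
  unfold value
  simp_rw [rootSum_eq_sum]
  exact integral_finsetSum _ fun v _ => integrable_mul_weight F hψ hX hX1 _

theorem abs_rootSum_sub_le (hG : (G.neighborSet o).Finite) {a b c : G.edgeSet → ℝ}
    (h : ∀ v : G.neighborSet o, |a (rootEdge v) - b (rootEdge v)| ≤ c (rootEdge v)) :
    |rootSum G o a - rootSum G o b| ≤ rootSum G o c := by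
  have := hG.fintype
  simp_rw [rootSum_eq_sum, ← Finset.sum_sub_distrib]
  exact (Finset.abs_sum_le_sum_abs _ _).trans (Finset.sum_le_sum fun v _ => h v)

theorem rootSum_const_mul (hG : (G.neighborSet o).Finite) (c : ℝ) (a : G.edgeSet → ℝ) :
    rootSum G o (fun e => c * a e) = c * rootSum G o a := by
  have := hG.fintype
  simp_rw [rootSum_eq_sum, Finset.mul_sum]

theorem rootSum_const (hG : (G.neighborSet o).Finite) (c : ℝ) :
    rootSum G o (fun _ => c) = c * rootDegree G o := by
  rw [rootDegree, ← rootSum_const_mul hG]; simp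

/-- As `|X| ≤ 1`, each root edge costs at most the L¹ distance of `ψ` and `ψ'`. The bound is linear
in the degree, which suffices for truncation and does not require `X` to come from a matching. -/
theorem abs_value_sub_value_le (hG : (G.neighborSet o).Finite)
    (F : Measure ℝ) [IsProbabilityMeasure F] {ψ ψ' : ℝ → ℝ}
    (hψ : Integrable ψ F) (hψ' : Integrable ψ' F) {X : (G.edgeSet → ℝ) → G.edgeSet → ℝ}
    (hX : ∀ e, Measurable fun w => X w e) (hX1 : ∀ w e, |X w e| ≤ 1) :
    |value F ψ G o X - value F ψ' G o X| ≤ (∫ x, |ψ x - ψ' x| ∂F) * rootDegree G o := by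
  rw [value_eq_rootSum hG F hψ hX hX1, value_eq_rootSum hG F hψ' hX hX1, ← rootSum_const hG]
  refine abs_rootSum_sub_le hG fun v => ?_
  rw [← integral_sub (integrable_mul_weight F hψ hX hX1 _) (integrable_mul_weight F hψ' hX hX1 _),
    ← integral_weight (ψ := fun x => |ψ x - ψ' x|) F (hψ.sub hψ').abs.aestronglyMeasurable
      (rootEdge v)]
  refine (abs_integral_le_integral_abs).trans (integral_mono_of_nonneg
    (Eventually.of_forall fun w => abs_nonneg _) (integrable_weight F (hψ.sub hψ').abs _)
    (Eventually.of_forall fun w => ?_))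
  dsimp only
  rw [← mul_sub, abs_mul]
  exact mul_le_of_le_one_left (abs_nonneg _) (hX1 _ _)

theorem abs_value_le (hG : (G.neighborSet o).Finite)
    (F : Measure ℝ) [IsProbabilityMeasure F] {ψ : ℝ → ℝ}
    (hψ : Integrable ψ F) {X : (G.edgeSet → ℝ) → G.edgeSet → ℝ}
    (hX : ∀ e, Measurable fun w => X w e) (hX1 : ∀ w e, |X w e| ≤ 1) :
    |value F ψ G o X| ≤ (∫ x, |ψ x| ∂F) * rootDegree G o := by
  have h := abs_value_sub_value_le hG F hψ (integrable_zero ℝ ℝ F) hX hX1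
  have h0 : value F 0 G o X = 0 := by simp [value, rootSum]
  simpa [h0] using h

theorem integrable_of_bounded (F : Measure ℝ) [IsProbabilityMeasure F] {ψ : ℝ → ℝ}
    (hψ : Measurable ψ) {C : ℝ} (hC : ∀ x, |ψ x| ≤ C) : Integrable ψ F :=
  Integrable.of_bound hψ.aestronglyMeasurable C (Eventually.of_forall hC)

theorem integrable_influence [Countable V] (hG : ∀ v, (G.neighborSet v).Finite)
    (F : Measure ℝ) [IsProbabilityMeasure F] (e : G.edgeSet) (r : ℕ) :
    Integrable (influence e r) (weightLaw F G) :=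
  Integrable.of_bound (measurable_influence e r
    (finite_vertexBoundary_edgeBall hG e r)).aestronglyMeasurable 1
    (Eventually.of_forall fun w => by
      rw [Real.norm_of_nonneg (influence_nonneg e r w)]; exact influence_le_one e r w)

theorem abs_mwmInd_le_one (H : G.Subgraph) (w : G.edgeSet → ℝ) (e : G.edgeSet) :
    |mwmInd H w e| ≤ 1 := by
  rcases mwmInd_eq_zero_or_one H w e with h | h <;> simp [h]

/-- If the root edges of the random set with indicator `X` are determined by the `r`-balls up to the
influence of the boundaries, then its value is close to the local value. -/
theorem abs_value_sub_localValue_le [Countable V] (hG : ∀ v, (G.neighborSet v).Finite)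
    (F : Measure ℝ) [IsProbabilityMeasure F] [NullSingletonClass F] {ψ : ℝ → ℝ}
    (hψ : Measurable ψ) {C : ℝ} (hC : ∀ x, |ψ x| ≤ C)
    {X : (G.edgeSet → ℝ) → G.edgeSet → ℝ} (hX : ∀ e, Measurable fun w => X w e)
    (hX1 : ∀ w e, |X w e| ≤ 1) (r : ℕ)
    (h : ∀ w, Generic w → ∀ e, |mwmInd (edgeBall e r) w e - X w e| ≤ influence e r w) :
    |value F ψ G o X - localValue F ψ G o (r + 1)| ≤ 2 * C * rootCorr F G o r := by
  have hC0 : 0 ≤ C := (abs_nonneg _).trans (hC 0)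
  have hψi := integrable_of_bounded F hψ hC
  have hY := fun e => measurable_mwmInd (G := G) (rootBall G o (r + 1)) e
  have hY1 := abs_mwmInd_le_one (G := G) (rootBall G o (r + 1))
  rw [localValue, value_eq_rootSum (hG o) F hψi hX hX1, value_eq_rootSum (hG o) F hψi hY hY1,
    rootCorr, ← rootSum_const_mul (hG o)]
  refine abs_rootSum_sub_le (hG o) fun v => ?_
  rw [← integral_sub (integrable_mul_weight F hψi hX hX1 _)
    (integrable_mul_weight F hψi hY hY1 _), corr_eq, ← integral_const_mul]
  refine (abs_integral_le_integral_abs).trans (integral_mono_of_nonneg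
    (Eventually.of_forall fun w => abs_nonneg _) ((integrable_influence hG F _ r).const_mul _) ?_)
  filter_upwards [ae_generic F] with w hw
  -- The indicator in the edge ball is the middle term of a triangle inequality, hence the factor
  -- `2`.
  have h1 := h w hw (rootEdge v)
  have h2 := hw.abs_mwmInd_sub_le (rootEdge v) r (rootBall G o (r + 1))
    (finite_edgeSet_of_finite_verts _ (finite_verts_rootBall hG o (r + 1)))
    (edgeBall_rootEdge_le v r)
  rw [← sub_mul, abs_mul, mul_comm, mul_comm 2 C, mul_assoc]
  refine mul_le_mul (hC _) ?_ (abs_nonneg _) hC0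
  rw [abs_le] at h1 h2 ⊢
  constructor <;> linarith [h1.1, h1.2, h2.1, h2.2]

/-- The root is incident to at most one edge of a matching. -/
theorem abs_rootSum_mwmInd_le {C : ℝ} (H : G.Subgraph) (hH : H.verts.Finite) (w : G.edgeSet → ℝ)
    {b : G.edgeSet → ℝ} (hC : ∀ e, |b e| ≤ C) (hC0 : 0 ≤ C) :
    |rootSum G o (fun e => mwmInd H w e * b e)| ≤ C := by
  classical
  obtain ⟨M, hM⟩ := exists_isMWM H (finite_edgeSet_of_finite_verts H hH) w
  have hsub := mwm_subset_isMWM hM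
  simp_rw [mwmInd_eq]
  unfold rootSum
  by_cases h : ∃ v : G.neighborSet o, rootEdge v ∈ mwm H w
  · obtain ⟨v, hv⟩ := h
    rw [finsum_eq_single _ v]
    · simpa [hv] using hC _
    · intro v' hv'
      have : rootEdge v' ∉ mwm H w := by
        intro hm
        refine hM.isMatching _ (hsub hm) _ (hsub hv) (fun h => hv' (rootEdge_injective h)) o ?_ ?_
        · exact Sym2.mem_mk_left _ _
        · exact Sym2.mem_mk_left _ _
      simp [this]
  · push Not at h
    simp [h, hC0]

/-- In contrast with `abs_value_le`, the bound does not involve the degree, so `localValue` is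
bounded over all rooted graphs and may serve as a test function. -/
theorem abs_value_mwmInd_le (F : Measure ℝ) [IsProbabilityMeasure F] {ψ : ℝ → ℝ} {C : ℝ}
    (hC : ∀ x, |ψ x| ≤ C) (H : G.Subgraph) (hH : H.verts.Finite) :
    |value F ψ G o (mwmInd H)| ≤ C := by
  have h := norm_integral_le_of_norm_le_const (μ := weightLaw F G) (C := C)
    (f := fun w => rootSum G o (fun e => mwmInd H w e * ψ (w e)))
    (Eventually.of_forall fun w => abs_rootSum_mwmInd_le H hH w (fun e => hC (w e))
      ((abs_nonneg _).trans (hC 0)))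
  rwa [probReal_univ, mul_one] at h

end Value

/-! ### Local quantities depend only on a ball around the root -/

section Locality

variable {U V : Type} {K : SimpleGraph U} {G : SimpleGraph V}

/-- The matching uses the ball of radius `r`, while the sum over root edges needs all neighbours of
the root, even for `r = 0`; radius `r + 1` serves both. -/
theorem localValue_map (F : Measure ℝ) [IsProbabilityMeasure F] {ψ : ℝ → ℝ} (hψ : Measurable ψ)
    [Countable U] (hK : ∀ v, (K.neighborSet v).Finite) {ι : K ↪g G} {o : U} {r : ℕ}
    (h : Covers ι o (r + 1)) : localValue F ψ G (ι o) r = localValue F ψ K o r := by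
  unfold localValue value
  rw [← integral_comp_mapEdgeSet F ι _
    (measurable_rootSum (hK o) hψ fun e => measurable_mwmInd (rootBall K o r) e)]
  refine integral_congr_ae (Eventually.of_forall fun w => ?_)
  dsimp only
  rw [rootSum_map (h.mono (by omega)), ← (h.mono (Nat.le_succ r)).map_rootBall]
  simp only [Function.comp_def, mwmInd_map]

/-- One unit of radius is spent on moving to the far endpoint of a root edge, and one on detecting
the boundary. -/
theorem rootCorr_map (F : Measure ℝ) [IsProbabilityMeasure F]
    [Countable U] (hK : ∀ v, (K.neighborSet v).Finite) {ι : K ↪g G} {o : U} {r : ℕ}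
    (h : Covers ι o (r + 2)) : rootCorr F G (ι o) r = rootCorr F K o r := by
  unfold rootCorr
  rw [rootSum_map (h.mono (by omega))]
  unfold rootSum
  refine finsum_congr fun v => corr_map F hK fun u hu => ?_
  rcases Sym2.mem_iff.mp hu with rfl | rfl
  · exact h.mono (by omega)
  · exact Covers.of_adj (u := o) h v.2

theorem rootDegree_map {ι : K ↪g G} {o : U} (h : Covers ι o 1) :
    rootDegree G (ι o) = rootDegree K o := rootSum_map h _

end Locality

/-! ### Continuity for the local metric -/

namespace RootedGraph

theorem countable_V (g : RootedGraph) : Countable g.V := by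
  have : (Set.univ : Set g.V) = ⋃ n : ℕ, {x | g.graph.edist g.root x ≤ n} := by
    symm
    rw [Set.eq_univ_iff_forall]
    intro x
    obtain ⟨p, hp⟩ := g.connected.exists_walk_length_eq_edist g.root x
    exact Set.mem_iUnion.2 ⟨p.length, hp.ge⟩
  rw [← Set.countable_univ_iff, this]
  exact Set.countable_iUnion fun n => (finite_setOf_edist_le g.locallyFinite g.root n).countable

theorem covers_induce_ball (g : RootedGraph) (R : ℕ) :
    Covers (SimpleGraph.Embedding.induce (G := g.graph) (g.ball R))
      ⟨g.root, g.root_mem_ball R⟩ R :=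
  fun x hx => ⟨⟨x, hx⟩, rfl⟩

theorem finite_neighborSet_induce {V : Type} {G : SimpleGraph V}
    (hG : ∀ v, (G.neighborSet v).Finite) (S : Set V) (v : S) :
    ((G.induce S).neighborSet v).Finite :=
  ((hG v).preimage Subtype.val_injective.injOn).subset fun _ hx => hx

/-- Quantities which are invariant under embeddings that cover large balls are equal for rooted
graphs with isomorphic balls. -/
theorem eq_of_ballIso {R : ℕ} (Φ : ∀ {V : Type}, SimpleGraph V → V → ℝ)
    (hΦ : ∀ {U V : Type} {K : SimpleGraph U} {G : SimpleGraph V} [Countable U]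
      (_ : ∀ v, (K.neighborSet v).Finite) {ι : K ↪g G} {o : U}, Covers ι o R → Φ G (ι o) = Φ K o)
    {g g' : RootedGraph} (h : BallIso g g' R) : Φ g.graph g.root = Φ g'.graph g'.root := by
  obtain ⟨φ, hφ⟩ := h
  have := g.countable_V
  have hK := finite_neighborSet_induce g.locallyFinite (g.ball R)
  -- The ball of `g` embeds into `g` by inclusion and into `g'` through `φ`; in both cases `Φ`
  -- agrees with its value on the ball.
  have h1 := hΦ hK (g.covers_induce_ball R)
  have h2 := hΦ hK (ι := (SimpleGraph.Embedding.induce (G := g'.graph) (g'.ball R)).comp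
    φ.toEmbedding) (o := ⟨g.root, g.root_mem_ball R⟩) (by
      intro x hx
      have hroot : ((SimpleGraph.Embedding.induce (G := g'.graph) (g'.ball R)).comp
        φ.toEmbedding) ⟨g.root, g.root_mem_ball R⟩ = g'.root := congrArg Subtype.val hφ
      rw [hroot] at hx
      refine ⟨φ.symm ⟨x, hx⟩, ?_⟩
      change ((φ (φ.symm ⟨x, hx⟩)) : g'.V) = x
      simp)
  have hroot : ((SimpleGraph.Embedding.induce (G := g'.graph) (g'.ball R)).comp
      φ.toEmbedding) ⟨g.root, g.root_mem_ball R⟩ = g'.root := congrArg Subtype.val hφ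
  rw [hroot] at h2
  exact h1.trans h2.symm

theorem ballIso_of_dist_lt {g g' : RootedGraph} {R : ℕ} (h : dist g g' < 1 / ((R : ℝ) + 1)) :
    BallIso g g' R := by
  refine ballIso_of_le ?_
  by_contra hlt
  push Not at hlt
  refine absurd h (not_lt.mpr ?_)
  change _ ≤ locDist g g'
  -- The agreement radius is now some `m < R`, and the distance `1 / (m + 1)` is too large.
  obtain ⟨m, hm⟩ := ENat.ne_top_iff_exists.mp hlt.ne_top
  rw [← hm] at hlt
  have hmR : m < R := by exact_mod_cast hlt
  have : locDist g g' = 1 / ((m : ℝ) + 1) := by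
    rw [locDist, ← hm]
    simp [ENNReal.toReal_inv, ENNReal.toReal_add]
  rw [this]
  gcongr

/-- Such a function is constant on balls of radius `1 / (R + 1)`. -/
theorem continuous_of_ballIso {R : ℕ} {f : RootedGraph → ℝ}
    (hf : ∀ g g', BallIso g g' R → f g = f g') : Continuous f := by
  rw [Metric.continuous_iff]
  intro g ε hε
  refine ⟨1 / ((R : ℝ) + 1), by positivity, fun g' hg' => ?_⟩
  rw [hf g' g (ballIso_of_dist_lt hg')]
  simpa using hε

theorem continuous_localValue (F : Measure ℝ) [IsProbabilityMeasure F] {ψ : ℝ → ℝ}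
    (hψ : Measurable ψ) (r : ℕ) :
    Continuous fun g : RootedGraph => localValue F ψ g.graph g.root r :=
  continuous_of_ballIso fun _ _ => eq_of_ballIso (R := r + 1) (fun G o => localValue F ψ G o r)
    fun hK _ _ h => localValue_map F hψ hK h

theorem continuous_rootCorr (F : Measure ℝ) [IsProbabilityMeasure F] (r : ℕ) :
    Continuous fun g : RootedGraph => rootCorr F g.graph g.root r :=
  continuous_of_ballIso fun _ _ => eq_of_ballIso (R := r + 2) (fun G o => rootCorr F G o r)
    fun hK _ _ h => rootCorr_map F hK h

theorem continuous_rootDegree :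
    Continuous fun g : RootedGraph => rootDegree g.graph g.root :=
  continuous_of_ballIso fun _ _ => eq_of_ballIso (R := 1) (fun G o => rootDegree G o)
    fun _ _ _ h => rootDegree_map h

end RootedGraph

/-! ### From a finite graph to the component of a vertex -/

namespace FiniteGraph

/-- Vertices at finite distance are in the same component, so no radius sees the rest of the graph.
-/
theorem covers_component (G : FiniteGraph) (o : Fin (G.k + 1)) (n : ℕ) :
    Covers (SimpleGraph.Embedding.induce (G := G.graph) (G.graph.connectedComponentMk o).supp)
      (G.rootedAt o).root n := by
  intro x hx
  have hr : G.graph.Reachable o x :=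
    SimpleGraph.reachable_of_edist_ne_top (ne_top_of_le_ne_top (ENat.natCast_ne_top _) hx)
  exact ⟨⟨x, SimpleGraph.ConnectedComponent.sound hr.symm⟩, rfl⟩

theorem localValue_rootedAt (F : Measure ℝ) [IsProbabilityMeasure F] {ψ : ℝ → ℝ}
    (hψ : Measurable ψ) (G : FiniteGraph) (o : Fin (G.k + 1)) (r : ℕ) :
    localValue F ψ (G.rootedAt o).graph (G.rootedAt o).root r = localValue F ψ G.graph o r :=
  have := (G.rootedAt o).countable_V
  (localValue_map F hψ (G.rootedAt o).locallyFinite (G.covers_component o (r + 1))).symm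

theorem rootCorr_rootedAt (F : Measure ℝ) [IsProbabilityMeasure F]
    (G : FiniteGraph) (o : Fin (G.k + 1)) (r : ℕ) :
    rootCorr F (G.rootedAt o).graph (G.rootedAt o).root r = rootCorr F G.graph o r :=
  have := (G.rootedAt o).countable_V
  (rootCorr_map F (G.rootedAt o).locallyFinite (G.covers_component o (r + 2))).symm

theorem rootDegree_rootedAt (G : FiniteGraph) (o : Fin (G.k + 1)) :
    rootDegree (G.rootedAt o).graph (G.rootedAt o).root = rootDegree G.graph o :=
  (rootDegree_map (G.covers_component o 1)).symm

end FiniteGraph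

/-! ### The matching of the limit graph along an exhaustion -/

section LimitMatching

variable {V : Type} {G : SimpleGraph V}

theorem IsExhaustion.eventually_le {H : ℕ → G.Subgraph} (hH : IsExhaustion H) (L : G.Subgraph)
    (hL : L.verts.Finite) : ∀ᶠ n in atTop, L ≤ H n := by
  have hv : ∀ᶠ n in atTop, ∀ v ∈ L.verts, v ∈ (H n).verts := by
    rw [eventually_all_finite hL]
    intro v _
    have : v ∈ (⨆ n, H n).verts := by rw [hH.iSup_eq]; trivial
    rw [SimpleGraph.Subgraph.verts_iSup] at this
    obtain ⟨n, hn⟩ := Set.mem_iUnion.mp this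
    exact eventually_atTop.2 ⟨n, fun m hm => (hH.mono hm).1 hn⟩
  have he : ∀ᶠ n in atTop, ∀ e ∈ {e : G.edgeSet | (e : Sym2 V) ∈ L.edgeSet},
      (e : Sym2 V) ∈ (H n).edgeSet := by
    rw [eventually_all_finite (finite_edgeSet_of_finite_verts L hL)]
    intro e _
    have : (e : Sym2 V) ∈ (⨆ n, H n).edgeSet := by rw [hH.iSup_eq]; exact e.2
    rw [SimpleGraph.Subgraph.edgeSet_iSup] at this
    obtain ⟨n, hn⟩ := Set.mem_iUnion.mp this
    exact eventually_atTop.2 ⟨n, fun m hm => SimpleGraph.Subgraph.edgeSet_mono (hH.mono hm) hn⟩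
  filter_upwards [hv, he] with n h1 h2
  exact ⟨h1, fun a b hab => h2 ⟨s(a, b), L.adj_sub hab⟩ hab⟩

/-- The indicator of the maximum weight matching constructed along the exhaustion `H`. -/
noncomputable def limitInd (H : ℕ → G.Subgraph) (w : G.edgeSet → ℝ) (e : G.edgeSet) : ℝ :=
  (limitMWM H w).indicator (fun _ => (1 : ℝ)) e

open Classical in
theorem limitInd_eq (H : ℕ → G.Subgraph) (w : G.edgeSet → ℝ) (e : G.edgeSet) :
    limitInd H w e = if e ∈ limitMWM H w then 1 else 0 := by
  simp [limitInd, Set.indicator_apply]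

theorem abs_limitInd_le_one (H : ℕ → G.Subgraph) (w : G.edgeSet → ℝ) (e : G.edgeSet) :
    |limitInd H w e| ≤ 1 := by
  rw [limitInd_eq]; split_ifs <;> simp

theorem measurable_limitInd [Countable V] (H : ℕ → G.Subgraph) (e : G.edgeSet) :
    Measurable (fun w => limitInd H w e) := by
  classical
  simp_rw [limitInd_eq]
  refine Measurable.ite ?_ measurable_const measurable_const
  have h := measurableSet_tendsto (l := atTop) (𝓝 (1 : ℝ)) (fun n => measurable_mwmInd (H n) e)
  exact h

/-- All indicators take the values `0` and `1`. If the influence is below `1`, every `H n`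
containing the ball gives the same answer as the ball, so the sequence is eventually constant with
that limit. Otherwise the bound is trivial, whether or not the sequence converges. -/
theorem Generic.abs_limitInd_sub_le {w : G.edgeSet → ℝ} (hw : Generic w)
    (hG : ∀ v, (G.neighborSet v).Finite) {H : ℕ → G.Subgraph} (hH : IsExhaustion H)
    (e : G.edgeSet) (r : ℕ) : |mwmInd (edgeBall e r) w e - limitInd H w e| ≤ influence e r w := by
  classical
  rcases lt_or_ge (influence e r w) 1 with hlt | hge
  · have hev : ∀ᶠ n in atTop, mwmInd (H n) w e = mwmInd (edgeBall e r) w e := by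
      filter_upwards [hH.eventually_le (edgeBall e r) (finite_verts_edgeBall hG e r)] with n hn
      have h := (hw.abs_mwmInd_sub_le e r (H n)
        (finite_edgeSet_of_finite_verts _ (hH.finite n)) hn).trans_lt hlt
      rcases mwmInd_eq_zero_or_one (H n) w e with h1 | h1 <;>
        rcases mwmInd_eq_zero_or_one (edgeBall e r) w e with h2 | h2 <;>
        simp [h1, h2] at h ⊢
    have ht : Tendsto (fun n => mwmInd (H n) w e) atTop (𝓝 (mwmInd (edgeBall e r) w e)) :=
      tendsto_const_nhds.congr' (hev.mono fun n hn => hn.symm)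
    have : limitInd H w e = mwmInd (edgeBall e r) w e := by
      rw [limitInd_eq]
      rcases mwmInd_eq_zero_or_one (edgeBall e r) w e with h | h
      · rw [h] at ht ⊢
        refine if_neg fun hm => ?_
        exact zero_ne_one (tendsto_nhds_unique ht hm)
      · rw [h] at ht ⊢
        exact if_pos ht
    rw [this, sub_self, abs_zero]
    exact influence_nonneg e r w
  · refine le_trans ?_ hge
    rw [limitInd_eq]
    rcases mwmInd_eq_zero_or_one (edgeBall e r) w e with h | h <;> rw [h] <;> split_ifs <;> simp

theorem tendsto_rootCorr {F : Measure ℝ} (hG : ∀ v, (G.neighborSet v).Finite)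
    (h : CorrelationDecay F G) (o : V) : Tendsto (fun r => rootCorr F G o r) atTop (𝓝 0) := by
  have := (hG o).fintype
  unfold rootCorr
  simp_rw [rootSum_eq_sum]
  rw [show (0 : ℝ) = ∑ v : G.neighborSet o, 0 by simp]
  exact tendsto_finsetSum _ fun v _ => h _

end LimitMatching

/-! ### Double counting and averages over the vertices -/

namespace FiniteGraph

/-- Summing over the edges at each vertex counts every edge twice. -/
theorem sum_rootSum (G : FiniteGraph) (a : G.graph.edgeSet → ℝ) :
    ∑ o, rootSum G.graph o a = 2 * ∑ᶠ e, a e := by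
  classical
  have := Fintype.ofFinite G.graph.edgeSet
  have h1 : ∀ o, rootSum G.graph o a =
      ∑ e : G.graph.edgeSet, if o ∈ (e : Sym2 (Fin (G.k + 1))) then a e else 0 := by
    intro o
    rw [rootSum_eq_sum, ← Finset.sum_filter]
    refine (Finset.sum_map Finset.univ
      ⟨rootEdge, rootEdge_injective (G := G.graph) (o := o)⟩ a).symm.trans ?_
    congr 1
    ext ⟨e, he⟩
    simp only [Finset.mem_map, Finset.mem_univ, true_and, Finset.mem_filter,
      Function.Embedding.coeFn_mk]
    constructor
    · rintro ⟨v, hv⟩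
      have h : s(o, (v : Fin (G.k + 1))) = e := congrArg Subtype.val hv
      rw [← h]
      exact Sym2.mem_mk_left _ _
    · intro ho
      obtain ⟨v, rfl⟩ := Sym2.mem_iff_exists.mp ho
      exact ⟨⟨v, he⟩, rfl⟩
  simp_rw [h1]
  rw [Finset.sum_comm, finsum_eq_sum_of_fintype, Finset.mul_sum]
  refine Finset.sum_congr rfl fun e _ => ?_
  rw [← Finset.sum_filter, Finset.sum_const, nsmul_eq_mul]
  congr 1
  obtain ⟨e, he⟩ := e
  induction e using Sym2.ind with
  | _ x y =>
    have hxy : x ≠ y := (G.graph.mem_edgeSet.mp he).ne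
    have : Finset.univ.filter (fun v => v ∈ s(x, y)) = {x, y} := by ext v; simp
    dsimp only
    rw [this, Finset.card_pair hxy]
    norm_num

theorem sum_rootDegree (G : FiniteGraph) : ∑ o, rootDegree G.graph o = 2 * G.numEdges := by
  have := Fintype.ofFinite G.graph.edgeSet
  unfold rootDegree
  rw [sum_rootSum, finsum_eq_sum_of_fintype, numEdges]
  simp

/-- Turns a total over the matching into a sum of root contributions, the form to which local
convergence applies. -/
theorem finsum_indicator_mwm (G : FiniteGraph) (w a : G.graph.edgeSet → ℝ) :
    ∑ᶠ e, (mwm (⊤ : G.graph.Subgraph) w).indicator a e =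
      1 / 2 * ∑ o, rootSum G.graph o (fun e => mwmInd ⊤ w e * a e) := by
  classical
  rw [sum_rootSum]
  simp_rw [mwmInd_eq, Set.indicator_apply, ite_mul, one_mul, zero_mul]
  ring

theorem matchingSize_eq (G : FiniteGraph) (w : G.graph.edgeSet → ℝ) :
    (G.matchingSize w : ℝ) =
      ∑ᶠ e, (mwm (⊤ : G.graph.Subgraph) w).indicator (fun _ => (1 : ℝ)) e := by
  classical
  have := Fintype.ofFinite G.graph.edgeSet
  rw [finsum_eq_sum_of_fintype, matchingSize, Set.ncard_eq_toFinset_card']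
  simp_rw [Set.indicator_apply]
  rw [Finset.sum_boole]
  congr 2
  ext e; simp

end FiniteGraph

namespace FiniteGraph

/-- The average of a function of the vertices. -/
noncomputable def average (G : FiniteGraph) (a : Fin (G.k + 1) → ℝ) : ℝ :=
  (∑ o, a o) / (G.numVerts : ℝ)

variable (G : FiniteGraph)

theorem numVerts_pos : (0 : ℝ) < G.numVerts := by
  unfold numVerts; positivity

theorem average_mono {a b : Fin (G.k + 1) → ℝ} (h : ∀ o, a o ≤ b o) :
    G.average a ≤ G.average b :=
  div_le_div_of_nonneg_right (Finset.sum_le_sum fun o _ => h o) G.numVerts_pos.le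

theorem average_sub (a b : Fin (G.k + 1) → ℝ) :
    G.average (fun o => a o - b o) = G.average a - G.average b := by
  simp [average, sub_div]

theorem average_const (c : ℝ) : G.average (fun _ => c) = c := by
  have := G.numVerts_pos.ne'
  unfold average
  rw [div_eq_iff this]
  simp [numVerts]
  ring

theorem average_const_mul (c : ℝ) (a : Fin (G.k + 1) → ℝ) :
    G.average (fun o => c * a o) = c * G.average a := by
  simp [average, ← Finset.mul_sum, mul_div_assoc]

theorem abs_average_le (a : Fin (G.k + 1) → ℝ) : |G.average a| ≤ G.average fun o => |a o| := by
  unfold average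
  rw [abs_div, abs_of_pos G.numVerts_pos]
  exact div_le_div_of_nonneg_right (Finset.abs_sum_le_sum_abs _ _) G.numVerts_pos.le

theorem abs_average_sub_le {a b c : Fin (G.k + 1) → ℝ} (h : ∀ o, |a o - b o| ≤ c o) :
    |G.average a - G.average b| ≤ G.average c := by
  rw [← average_sub]
  exact (G.abs_average_le _).trans (G.average_mono h)

theorem abs_average_le_const {a : Fin (G.k + 1) → ℝ} {C : ℝ} (h : ∀ o, |a o| ≤ C) :
    |G.average a| ≤ C :=
  (G.abs_average_le _).trans ((G.average_mono h).trans (G.average_const C).le)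

theorem average_rootDegree :
    G.average (fun o => rootDegree G.graph o) = 2 * (G.numEdges / G.numVerts) := by
  rw [average, sum_rootDegree]; ring

theorem aestronglyMeasurable (ν : Measure FiniteGraph) (f : FiniteGraph → ℝ) :
    AEStronglyMeasurable f ν :=
  (measurable_from_top (f := f)).aestronglyMeasurable

end FiniteGraph

/-! ### Degree bounds and truncation -/

/-- The mean degree of a finite random graph is bounded by twice a bound on its edge density. -/
theorem integrable_average_rootDegree {ν : Measure FiniteGraph} {D : ℝ}
    (hD : (∫⁻ G, ((G.numEdges : ENNReal) / (G.numVerts : ENNReal)) ∂ν) ≤ ENNReal.ofReal D)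
    (hD0 : 0 ≤ D) :
    Integrable (fun G : FiniteGraph => G.average fun o => rootDegree G.graph o) ν ∧
      ∫ G : FiniteGraph, (G.average fun o => rootDegree G.graph o) ∂ν ≤ 2 * D := by
  simp_rw [FiniteGraph.average_rootDegree]
  have hnn : ∀ G : FiniteGraph, (0 : ℝ) ≤ G.numEdges / G.numVerts := fun G => by positivity
  have heq : ∀ G : FiniteGraph, ENNReal.ofReal ((G.numEdges : ℝ) / G.numVerts) =
      (G.numEdges : ENNReal) / (G.numVerts : ENNReal) := fun G => by
    rw [ENNReal.ofReal_div_of_pos G.numVerts_pos, ENNReal.ofReal_natCast, ENNReal.ofReal_natCast]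
  simp_rw [← heq] at hD
  have hi : Integrable (fun G : FiniteGraph => (G.numEdges : ℝ) / G.numVerts) ν :=
    (lintegral_ofReal_ne_top_iff_integrable (FiniteGraph.aestronglyMeasurable _ _)
      (Eventually.of_forall hnn)).1 (hD.trans_lt ENNReal.ofReal_lt_top).ne
  refine ⟨hi.const_mul 2, ?_⟩
  rw [integral_const_mul]
  rw [← ofReal_integral_eq_lintegral_ofReal hi (Eventually.of_forall hnn)] at hD
  linarith [(ENNReal.ofReal_le_ofReal_iff hD0).1 hD]

/-- Dominated convergence with bound `|ψ|`: truncation moves values towards `0`, and at each point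
it is inactive once `k ≥ |ψ x|`. -/
theorem tendsto_integral_truncation {F : Measure ℝ} {ψ : ℝ → ℝ} (hψ : Integrable ψ F) :
    Tendsto (fun k : ℕ => ∫ x, |ψ x - max (-(k : ℝ)) (min k (ψ x))| ∂F) atTop (𝓝 0) := by
  have := tendsto_integral_of_dominated_convergence (μ := F)
    (F := fun (k : ℕ) x => |ψ x - max (-(k : ℝ)) (min k (ψ x))|)
    (f := fun _ => (0 : ℝ)) (fun x => |ψ x|) (fun k => ?_) hψ.abs (fun k => ?_) ?_
  · simpa using this
  · exact (hψ.aestronglyMeasurable.sub (aestronglyMeasurable_const.sup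
      (aestronglyMeasurable_const.inf hψ.aestronglyMeasurable))).norm
  · refine Eventually.of_forall fun x => ?_
    have hk : (0 : ℝ) ≤ k := Nat.cast_nonneg k
    rw [Real.norm_eq_abs, abs_abs]
    rcases max_cases (-(k : ℝ)) (min k (ψ x)) with h | h <;>
      rcases min_cases (k : ℝ) (ψ x) with h' | h' <;>
      rcases abs_cases (ψ x) with h3 | h3 <;> rw [abs_le] <;> constructor <;> linarith
  · refine Eventually.of_forall fun x => tendsto_const_nhds.congr' ?_
    filter_upwards [tendsto_natCast_atTop_atTop.eventually (eventually_ge_atTop |ψ x|)] with k hk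
    rw [abs_le] at hk
    rw [min_eq_right hk.2, max_eq_right hk.1, sub_self, abs_zero]

theorem integrable_average {ν : Measure FiniteGraph} [IsProbabilityMeasure ν]
    {a : ∀ G : FiniteGraph, Fin (G.k + 1) → ℝ} {C : ℝ}
    (h : ∀ G o, |a G o| ≤ C) : Integrable (fun G : FiniteGraph => G.average (a G)) ν :=
  Integrable.of_bound (FiniteGraph.aestronglyMeasurable _ _) C
    (Eventually.of_forall fun G => G.abs_average_le_const (h G))

/-- The degree is continuous but unbounded, so it is not a test function. Its truncations at `k`
are, and inherit the bound `D` from the finite graphs; Fatou's lemma removes the truncation. -/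
theorem integrable_rootDegree {ν : ℕ → Measure FiniteGraph} {μ : Measure RootedGraph}
    [IsProbabilityMeasure μ] (hconv : LocalWeakConvergence ν μ) {D : ℝ}
    (hD : ∀ n, Integrable (fun G : FiniteGraph => G.average fun o => rootDegree G.graph o) (ν n) ∧
      ∫ G : FiniteGraph, (G.average fun o => rootDegree G.graph o) ∂(ν n) ≤ D) (hD0 : 0 ≤ D) :
    Integrable (fun g : RootedGraph => rootDegree g.graph g.root) μ ∧
      ∫ g : RootedGraph, rootDegree g.graph g.root ∂μ ≤ D := by
  have hmin : ∀ (k : ℕ) (g : RootedGraph), 0 ≤ min (k : ℝ) (rootDegree g.graph g.root) :=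
    fun k g => le_min (by positivity) rootDegree_nonneg
  set m : ℕ → RootedGraph →ᵇ ℝ := fun k => ofNormedAddCommGroup
    (fun g => min (k : ℝ) (rootDegree g.graph g.root))
    (continuous_const.min RootedGraph.continuous_rootDegree) k
    (fun g => by rw [Real.norm_of_nonneg (hmin k g)]; exact min_le_left _ _)
  have hm : ∀ k, ∫ g, m k g ∂μ ≤ D := by
    intro k
    refine le_of_tendsto' (hconv (m k)) fun n => ?_
    refine (integral_mono_of_nonneg (Eventually.of_forall fun G => ?_) (hD n).1
      (Eventually.of_forall fun G => ?_)).trans (hD n).2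
    · exact div_nonneg (Finset.sum_nonneg fun o _ => hmin k _) G.numVerts_pos.le
    · refine G.average_mono fun o => ?_
      rw [← FiniteGraph.rootDegree_rootedAt]
      exact min_le_right _ _
  have hlim : ∀ g : RootedGraph, Tendsto (fun k => m k g) atTop
      (𝓝 (rootDegree g.graph g.root)) := by
    intro g
    refine tendsto_const_nhds.congr' ?_
    filter_upwards [tendsto_natCast_atTop_atTop.eventually
      (eventually_ge_atTop (rootDegree g.graph g.root))] with k hk
    exact (min_eq_right hk).symm
  have hmeas : AEStronglyMeasurable (fun g : RootedGraph => rootDegree g.graph g.root) μ :=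
    RootedGraph.continuous_rootDegree.measurable.aestronglyMeasurable
  have hnn : 0 ≤ᵐ[μ] fun g : RootedGraph => rootDegree g.graph g.root :=
    Eventually.of_forall fun g => rootDegree_nonneg
  have hle : ∫⁻ g : RootedGraph, ENNReal.ofReal (rootDegree g.graph g.root) ∂μ ≤
      ENNReal.ofReal D := by
    have h1 : ∀ g : RootedGraph, ENNReal.ofReal (rootDegree g.graph g.root) =
        liminf (fun k => ENNReal.ofReal (m k g)) atTop := fun g =>
      ((ENNReal.continuous_ofReal.tendsto _).comp (hlim g)).liminf_eq.symm
    simp_rw [h1]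
    refine (lintegral_liminf_le fun k =>
      ENNReal.measurable_ofReal.comp (m k).continuous.measurable).trans ?_
    refine (liminf_le_liminf (v := fun _ => ENNReal.ofReal D)
      (Eventually.of_forall fun k => ?_)).trans (liminf_const _).le
    change ∫⁻ g, ENNReal.ofReal (m k g) ∂μ ≤ _
    rw [← ofReal_integral_eq_lintegral_ofReal ((m k).integrable μ)
      (Eventually.of_forall (hmin k))]
    exact ENNReal.ofReal_le_ofReal (hm k)
  have hi := (lintegral_ofReal_ne_top_iff_integrable hmeas hnn).1
    (hle.trans_lt ENNReal.ofReal_lt_top).ne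
  refine ⟨hi, ?_⟩
  rw [← ofReal_integral_eq_lintegral_ofReal hi hnn] at hle
  exact (ENNReal.ofReal_le_ofReal_iff hD0).1 hle

/-! ### Passage to the local limit -/

section Convergence

variable {ν : ℕ → Measure FiniteGraph} [∀ n, IsProbabilityMeasure (ν n)]
  {μ : Measure RootedGraph} [IsProbabilityMeasure μ]

/-- A function which is approximated by bounded continuous functions of the local metric, with
errors controlled by bounded continuous functions which tend to `0` in the limit, converges. -/
theorem tendsto_integral_of_local_approx (hconv : LocalWeakConvergence ν μ)
    {a : ∀ G : FiniteGraph, Fin (G.k + 1) → ℝ} {C : ℝ} (ha : ∀ G o, |a G o| ≤ C)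
    {f : RootedGraph → ℝ} {φ h : ℕ → RootedGraph →ᵇ ℝ} (h0 : ∀ r g, 0 ≤ h r g)
    {c : ℝ} (hc : ∀ r g, h r g ≤ c)
    (hap : ∀ r G o, |a G o - φ r (G.rootedAt o)| ≤ h r (G.rootedAt o))
    (hfp : ∀ᵐ g ∂μ, ∀ r, |f g - φ r g| ≤ h r g)
    (hlim : ∀ᵐ g ∂μ, Tendsto (fun r => h r g) atTop (𝓝 0)) :
    Integrable f μ ∧
      Tendsto (fun n => ∫ G : FiniteGraph, G.average (a G) ∂(ν n)) atTop (𝓝 (∫ g, f g ∂μ)) := by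
  have hφf : ∀ᵐ g ∂μ, Tendsto (fun r => φ r g) atTop (𝓝 (f g)) := by
    filter_upwards [hfp, hlim] with g h1 h2
    rw [tendsto_iff_norm_sub_tendsto_zero]
    refine squeeze_zero (fun _ => norm_nonneg _) (fun r => ?_) h2
    rw [norm_sub_rev]
    exact h1 r
  -- `f` is not assumed measurable; it is an almost everywhere limit of continuous functions.
  have hfm : AEStronglyMeasurable f μ :=
    aestronglyMeasurable_of_tendsto_ae atTop
      (fun r => (φ r).continuous.measurable.aestronglyMeasurable) hφf
  have hfi : Integrable f μ := by
    refine (((φ 0).integrable μ).abs.add ((h 0).integrable μ)).mono' hfm ?_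
    filter_upwards [hfp] with g hg
    have := abs_sub_abs_le_abs_sub (f g) (φ 0 g)
    have := hg 0
    simp only [Real.norm_eq_abs, Pi.add_apply]
    linarith
  refine ⟨hfi, ?_⟩
  have hh : Tendsto (fun r => ∫ g, h r g ∂μ) atTop (𝓝 0) := by
    have := tendsto_integral_of_dominated_convergence (μ := μ) (F := fun r g => h r g)
      (f := fun _ => (0 : ℝ)) (fun _ => c)
      (fun r => (h r).continuous.measurable.aestronglyMeasurable) (integrable_const c)
      (fun r => Eventually.of_forall fun g => by
        rw [Real.norm_of_nonneg (h0 r g)]; exact hc r g) hlim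
    simpa using this
  rw [Metric.tendsto_atTop]
  intro ε hε
  -- The radius is fixed through the limit graph, before `n`. The error on the finite graphs then
  -- stays below `ε / 2`, which with `ε / 4` for the error at the limit and `ε / 4` for the
  -- convergence of `φ r` makes `ε`.
  obtain ⟨r, hr⟩ := (hh.eventually (gt_mem_nhds (show (0 : ℝ) < ε / 4 by positivity))).exists
  have e1 := (hconv (φ r)).eventually (Metric.ball_mem_nhds _ (show 0 < ε / 4 by positivity))
  have e2 := (hconv (h r)).eventually (gt_mem_nhds (show (∫ g, h r g ∂μ) < ε / 2 by linarith))
  obtain ⟨N, hN⟩ := eventually_atTop.1 (e1.and e2)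
  refine ⟨N, fun n hn => ?_⟩
  obtain ⟨h1, h2⟩ := hN n hn
  have i1 : Integrable (fun G : FiniteGraph => G.average (a G)) (ν n) := integrable_average ha
  have i2 : Integrable (fun G : FiniteGraph => G.average fun o => φ r (G.rootedAt o)) (ν n) :=
    integrable_average (C := ‖φ r‖) fun G o => (φ r).norm_coe_le_norm _
  have i3 : Integrable (fun G : FiniteGraph => G.average fun o => h r (G.rootedAt o)) (ν n) :=
    integrable_average (C := ‖h r‖) fun G o => (h r).norm_coe_le_norm _
  have d1 : |∫ G : FiniteGraph, G.average (a G) ∂(ν n) -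
      ∫ G : FiniteGraph, (G.average fun o => φ r (G.rootedAt o)) ∂(ν n)| ≤
      ∫ G : FiniteGraph, (G.average fun o => h r (G.rootedAt o)) ∂(ν n) := by
    rw [← integral_sub i1 i2]
    exact abs_integral_le_integral_abs.trans (integral_mono_of_nonneg
      (Eventually.of_forall fun _ => abs_nonneg _) i3
      (Eventually.of_forall fun G => G.abs_average_sub_le (hap r G)))
  have d2 : |∫ g, f g ∂μ - ∫ g, φ r g ∂μ| ≤ ∫ g, h r g ∂μ := by
    rw [← integral_sub hfi ((φ r).integrable μ)]
    refine abs_integral_le_integral_abs.trans (integral_mono_of_nonneg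
      (Eventually.of_forall fun _ => abs_nonneg _) ((h r).integrable μ) ?_)
    filter_upwards [hfp] with g hg
    exact hg r
  change ∫ G : FiniteGraph, (G.average fun o => h r (G.rootedAt o)) ∂(ν n) < ε / 2 at h2
  change |∫ G : FiniteGraph, (G.average fun o => φ r (G.rootedAt o)) ∂(ν n) - _| < ε / 4 at h1
  rw [Real.dist_eq]
  rw [abs_le] at d1 d2
  rw [abs_lt] at h1 ⊢
  constructor <;> linarith [d1.1, d1.2, d2.1, d2.2, h1.1, h1.2]

variable (F : Measure ℝ) [IsProbabilityMeasure F] [NullSingletonClass F]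

/-- The convergence of the expected root contribution for bounded functions of the weights. -/
theorem tendsto_value_of_bounded (hconv : LocalWeakConvergence ν μ)
    (hdecay : ∀ᵐ g ∂μ, CorrelationDecay F g.graph)
    {H : ∀ g : RootedGraph, ℕ → g.graph.Subgraph} (hH : ∀ g, IsExhaustion (H g))
    {ψ : ℝ → ℝ} (hψ : Measurable ψ) {C : ℝ} (hC : ∀ x, |ψ x| ≤ C) :
    Integrable (fun g : RootedGraph => value F ψ g.graph g.root (limitInd (H g))) μ ∧
      Tendsto (fun n => ∫ G : FiniteGraph,
        (G.average fun o => value F ψ G.graph o (mwmInd ⊤)) ∂(ν n)) atTop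
        (𝓝 (∫ g : RootedGraph, value F ψ g.graph g.root (limitInd (H g)) ∂μ)) := by
  have hC0 : 0 ≤ C := (abs_nonneg _).trans (hC 0)
  have hloc : ∀ r (g : RootedGraph), |localValue F ψ g.graph g.root r| ≤ C := fun r g =>
    abs_value_mwmInd_le F hC _ (finite_verts_rootBall g.locallyFinite _ _)
  set φ : ℕ → RootedGraph →ᵇ ℝ := fun r => ofNormedAddCommGroup
    (fun g => localValue F ψ g.graph g.root (r + 1)) (RootedGraph.continuous_localValue F hψ _) C
    (hloc (r + 1))
  -- `rootCorr` need not be bounded over all graphs. It enters capped at `2 * C`, which bounds any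
  -- difference of two quantities of absolute value at most `C`.
  have hmin : ∀ r (g : RootedGraph), 0 ≤ min (2 * C) (2 * C * rootCorr F g.graph g.root r) :=
    fun r g => le_min (by positivity) (mul_nonneg (by positivity) (rootCorr_nonneg F r))
  set h : ℕ → RootedGraph →ᵇ ℝ := fun r => ofNormedAddCommGroup
    (fun g => min (2 * C) (2 * C * rootCorr F g.graph g.root r))
    (continuous_const.min (continuous_const.mul (RootedGraph.continuous_rootCorr F r))) (2 * C)
    (fun g => by rw [Real.norm_of_nonneg (hmin r g)]; exact min_le_left _ _)
  have hfin : ∀ (G : FiniteGraph) o, |value F ψ G.graph o (mwmInd ⊤)| ≤ C := fun G o =>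
    abs_value_mwmInd_le F hC _ (Set.toFinite _)
  have hval : ∀ (g : RootedGraph) (r : ℕ),
      |value F ψ g.graph g.root (limitInd (H g)) - localValue F ψ g.graph g.root (r + 1)| ≤
        2 * C * rootCorr F g.graph g.root r := by
    intro g r
    have := g.countable_V
    exact abs_value_sub_localValue_le g.locallyFinite F hψ hC (measurable_limitInd (H g))
      (abs_limitInd_le_one (H g)) r
      fun w hw e => hw.abs_limitInd_sub_le g.locallyFinite (hH g) e r
  refine tendsto_integral_of_local_approx hconv (φ := φ) (h := h) hfin hmin (c := 2 * C)
    (fun r g => min_le_left _ _) ?_ ?_ ?_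
  · intro r G o
    change |_ - localValue F ψ (G.rootedAt o).graph (G.rootedAt o).root (r + 1)| ≤
      min (2 * C) (2 * C * rootCorr F (G.rootedAt o).graph (G.rootedAt o).root r)
    have h1 := hloc (r + 1) (G.rootedAt o)
    rw [FiniteGraph.localValue_rootedAt F hψ, FiniteGraph.rootCorr_rootedAt] at *
    refine le_min ?_ ?_
    · have := abs_sub (value F ψ G.graph o (mwmInd ⊤)) (localValue F ψ G.graph o (r + 1))
      linarith [hfin G o]
    · exact abs_value_sub_localValue_le (fun _ => Set.toFinite _) F hψ hC (measurable_mwmInd ⊤)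
        (abs_mwmInd_le_one ⊤) r fun w hw e =>
          hw.abs_mwmInd_sub_le e r ⊤ (Set.toFinite _) le_top
  · filter_upwards [hdecay] with g hg r
    change |_ - localValue F ψ g.graph g.root (r + 1)| ≤
      min (2 * C) (2 * C * rootCorr F g.graph g.root r)
    refine le_min ?_ (hval g r)
    -- `limitMWM (H g) w` has not been shown to be a matching, so the bound `C` on its value is
    -- inherited from the local values, which converge to it by decay.
    have ht : Tendsto (fun r => |localValue F ψ g.graph g.root (r + 1)|) atTop
        (𝓝 |value F ψ g.graph g.root (limitInd (H g))|) := by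
      refine Tendsto.abs ?_
      rw [tendsto_iff_norm_sub_tendsto_zero]
      refine squeeze_zero (fun _ => norm_nonneg _) (fun r => ?_)
        (by simpa using (tendsto_rootCorr g.locallyFinite hg g.root).const_mul (2 * C))
      rw [norm_sub_rev]
      exact hval g r
    have h1 := le_of_tendsto' ht fun r => hloc (r + 1) g
    have := abs_sub (value F ψ g.graph g.root (limitInd (H g)))
      (localValue F ψ g.graph g.root (r + 1))
    linarith [hloc (r + 1) g]
  · filter_upwards [hdecay] with g hg
    change Tendsto (fun r => min (2 * C) (2 * C * rootCorr F g.graph g.root r)) atTop (𝓝 0)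
    have := (tendsto_const_nhds (x := 2 * C)).min
      ((tendsto_rootCorr g.locallyFinite hg g.root).const_mul (2 * C))
    simpa [hC0] using this

/-- The convergence of the expected root contribution for integrable functions of the weights. -/
theorem tendsto_value (hconv : LocalWeakConvergence ν μ)
    (hratio : (⨆ n, ∫⁻ G, ((G.numEdges : ENNReal) / (G.numVerts : ENNReal)) ∂(ν n)) < ⊤)
    (hdecay : ∀ᵐ g ∂μ, CorrelationDecay F g.graph)
    {H : ∀ g : RootedGraph, ℕ → g.graph.Subgraph} (hH : ∀ g, IsExhaustion (H g))
    {ψ : ℝ → ℝ} (hψ : Measurable ψ) (hψi : Integrable ψ F) :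
    (∀ n, Integrable (fun G : FiniteGraph =>
        G.average fun o => value F ψ G.graph o (mwmInd ⊤)) (ν n)) ∧
      Integrable (fun g : RootedGraph => value F ψ g.graph g.root (limitInd (H g))) μ ∧
      Tendsto (fun n => ∫ G : FiniteGraph,
        (G.average fun o => value F ψ G.graph o (mwmInd ⊤)) ∂(ν n)) atTop
        (𝓝 (∫ g : RootedGraph, value F ψ g.graph g.root (limitInd (H g)) ∂μ)) := by
  set S := ⨆ n, ∫⁻ G, ((G.numEdges : ENNReal) / (G.numVerts : ENNReal)) ∂(ν n)
  -- The average degree is twice the ratio of edges to vertices.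
  set D : ℝ := 2 * S.toReal
  have hD0 : 0 ≤ D := by positivity
  have hDn := fun n => integrable_average_rootDegree (ν := ν n) (D := S.toReal)
    (by rw [ENNReal.ofReal_toReal hratio.ne]; exact le_iSup (fun n => ∫⁻ G : FiniteGraph,
          ((G.numEdges : ENNReal) / (G.numVerts : ENNReal)) ∂(ν n)) n) (by positivity)
  have hDμ := integrable_rootDegree hconv hDn hD0
  set Ψ : ℕ → ℝ → ℝ := fun k x => max (-(k : ℝ)) (min k (ψ x))
  have hΨ : ∀ k, Measurable (Ψ k) := fun k => by fun_prop
  have hΨC : ∀ k x, |Ψ k x| ≤ k := fun k x =>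
    abs_le.2 ⟨le_max_left _ _, max_le (by linarith [(Nat.cast_nonneg k : (0 : ℝ) ≤ k)])
      (min_le_left _ _)⟩
  have hΨi : ∀ k, Integrable (Ψ k) F := fun k => integrable_of_bounded F (hΨ k) (hΨC k)
  set T : ℕ → ℝ := fun k => ∫ x, |ψ x - Ψ k x| ∂F
  have hT : Tendsto T atTop (𝓝 0) := tendsto_integral_truncation hψi
  have hT0 : ∀ k, 0 ≤ T k := fun k => integral_nonneg fun x => abs_nonneg _
  have hk := fun k => tendsto_value_of_bounded F hconv hdecay hH (hΨ k) (hΨC k)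
  have hG : ∀ k (G : FiniteGraph) o, |value F ψ G.graph o (mwmInd ⊤) -
      value F (Ψ k) G.graph o (mwmInd ⊤)| ≤ T k * rootDegree G.graph o := fun k G o =>
    abs_value_sub_value_le (Set.toFinite _) F hψi (hΨi k) (measurable_mwmInd ⊤)
      (abs_mwmInd_le_one ⊤)
  have hg : ∀ k (g : RootedGraph), |value F ψ g.graph g.root (limitInd (H g)) -
      value F (Ψ k) g.graph g.root (limitInd (H g))| ≤ T k * rootDegree g.graph g.root := by
    intro k g
    have := g.countable_V
    exact abs_value_sub_value_le (g.locallyFinite _) F hψi (hΨi k) (measurable_limitInd (H g))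
      (abs_limitInd_le_one (H g))
  have iG : ∀ n, Integrable (fun G : FiniteGraph =>
      G.average fun o => value F ψ G.graph o (mwmInd ⊤)) (ν n) := by
    intro n
    refine ((hDn n).1.const_mul (∫ x, |ψ x| ∂F)).mono' (FiniteGraph.aestronglyMeasurable _ _)
      (Eventually.of_forall fun G => ?_)
    rw [← G.average_const_mul]
    exact (G.abs_average_le _).trans (G.average_mono fun o =>
      abs_value_le (Set.toFinite _) F hψi (measurable_mwmInd ⊤) (abs_mwmInd_le_one ⊤))
  have iGk : ∀ k n, Integrable (fun G : FiniteGraph =>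
      G.average fun o => value F (Ψ k) G.graph o (mwmInd ⊤)) (ν n) := fun k n =>
    integrable_average fun G o => abs_value_mwmInd_le F (hΨC k) _ (Set.toFinite _)
  have ig : Integrable (fun g : RootedGraph => value F ψ g.graph g.root (limitInd (H g))) μ := by
    refine (hDμ.1.const_mul (∫ x, |ψ x| ∂F)).mono' ?_ (Eventually.of_forall fun g => ?_)
    -- Measurability in `g`, for an arbitrary choice of exhaustions, comes from the bounded case as
    -- `k` tends to infinity.
    · refine aestronglyMeasurable_of_tendsto_ae atTop
        (fun k => (hk k).1.aestronglyMeasurable) (Eventually.of_forall fun g => ?_)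
      rw [tendsto_iff_norm_sub_tendsto_zero]
      refine squeeze_zero (fun _ => norm_nonneg _) (fun k => ?_)
        (by simpa using hT.mul_const (rootDegree g.graph g.root))
      rw [norm_sub_rev]
      exact hg k g
    · have := g.countable_V
      exact abs_value_le (g.locallyFinite _) F hψi (measurable_limitInd (H g))
        (abs_limitInd_le_one (H g))
  refine ⟨iG, ig, ?_⟩
  rw [Metric.tendsto_atTop]
  intro ε hε
  have hTD : Tendsto (fun k => T k * D) atTop (𝓝 0) := by simpa using hT.mul_const D
  -- The truncation level is chosen before `n`: its cost `T k * D` is uniform in `n` and also bounds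
  -- the cost in the limit, so three errors below `ε / 4` remain.
  obtain ⟨k, hkε⟩ := (hTD.eventually (gt_mem_nhds (show (0 : ℝ) < ε / 4 by positivity))).exists
  obtain ⟨N, hN⟩ := Metric.tendsto_atTop.1 (hk k).2 (ε / 4) (by positivity)
  refine ⟨N, fun n hn => ?_⟩
  have h1 := hN n hn
  have d1 : |∫ G : FiniteGraph, (G.average fun o => value F ψ G.graph o (mwmInd ⊤)) ∂(ν n) -
      ∫ G : FiniteGraph, (G.average fun o => value F (Ψ k) G.graph o (mwmInd ⊤)) ∂(ν n)| ≤
      T k * D := by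
    rw [← integral_sub (iG n) (iGk k n)]
    refine abs_integral_le_integral_abs.trans ((integral_mono_of_nonneg
      (Eventually.of_forall fun _ => abs_nonneg _) ((hDn n).1.const_mul (T k))
      (Eventually.of_forall fun G => ?_)).trans ?_)
    · dsimp only
      rw [← G.average_const_mul]
      exact G.abs_average_sub_le (hG k G)
    · rw [integral_const_mul]
      exact mul_le_mul_of_nonneg_left (hDn n).2 (hT0 k)
  have d2 : |∫ g : RootedGraph, value F ψ g.graph g.root (limitInd (H g)) ∂μ -
      ∫ g : RootedGraph, value F (Ψ k) g.graph g.root (limitInd (H g)) ∂μ| ≤ T k * D := by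
    rw [← integral_sub ig (hk k).1]
    refine abs_integral_le_integral_abs.trans ((integral_mono_of_nonneg
      (Eventually.of_forall fun _ => abs_nonneg _) (hDμ.1.const_mul (T k))
      (Eventually.of_forall (hg k))).trans ?_)
    rw [integral_const_mul]
    exact mul_le_mul_of_nonneg_left hDμ.2 (hT0 k)
  rw [Real.dist_eq] at h1 ⊢
  rw [abs_le] at d1 d2
  rw [abs_lt] at h1 ⊢
  constructor <;> linarith [d1.1, d1.2, d2.1, d2.2, h1.1, h1.2]

/-- The convergence of the sum of a function of the weights over the maximum weight matching, for
nonnegative integrable functions. -/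
theorem tendsto_expect_matching (hconv : LocalWeakConvergence ν μ)
    (hratio : (⨆ n, ∫⁻ G, ((G.numEdges : ENNReal) / (G.numVerts : ENNReal)) ∂(ν n)) < ⊤)
    (hdecay : ∀ᵐ g ∂μ, CorrelationDecay F g.graph)
    {H : ∀ g : RootedGraph, ℕ → g.graph.Subgraph} (hH : ∀ g, IsExhaustion (H g))
    {ψ : ℝ → ℝ} (hψ : Measurable ψ) (hψi : Integrable ψ F) (hψ0 : ∀ᵐ x ∂F, 0 ≤ ψ x) :
    (∀ n, FiniteExpect (ν n) (fun G => weightLaw F G.graph)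
        (fun G w => (∑ᶠ e, (mwm (⊤ : G.graph.Subgraph) w).indicator (fun e => ψ (w e)) e) /
          (G.numVerts : ℝ))) ∧
      FiniteExpect μ (fun g => weightLaw F g.graph)
        (fun g w => g.rootWeight (limitMWM (H g) w) (fun e => ψ (w e))) ∧
      Tendsto (fun n => expect (ν n) (fun G => weightLaw F G.graph)
        (fun G w => (∑ᶠ e, (mwm (⊤ : G.graph.Subgraph) w).indicator (fun e => ψ (w e)) e) /
          (G.numVerts : ℝ))) atTop
        (𝓝 (1 / 2 * expect μ (fun g => weightLaw F g.graph)
          (fun g w => g.rootWeight (limitMWM (H g) w) (fun e => ψ (w e))))) := by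
  obtain ⟨iG, ig, ht⟩ := tendsto_value F hconv hratio hdecay hH hψ hψi
  have hroot : ∀ (g : RootedGraph) (w : g.graph.edgeSet → ℝ),
      g.rootWeight (limitMWM (H g) w) (fun e => ψ (w e)) =
        rootSum g.graph g.root (fun e => limitInd (H g) w e * ψ (w e)) := by
    classical
    intro g w
    simp_rw [limitInd_eq, ite_mul, one_mul, zero_mul]
    unfold RootedGraph.rootWeight rootSum
    simp_rw [Set.indicator_apply]
    rfl
  have hint : ∀ (G : FiniteGraph) o, Integrable (fun w => rootSum G.graph o
      (fun e => mwmInd ⊤ w e * ψ (w e))) (weightLaw F G.graph) := fun G o =>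
    integrable_rootSum (Set.toFinite _) F hψi (measurable_mwmInd ⊤) (abs_mwmInd_le_one ⊤)
  have hval : ∀ G : FiniteGraph, ∫ w, (∑ᶠ e, (mwm (⊤ : G.graph.Subgraph) w).indicator
      (fun e => ψ (w e)) e) / (G.numVerts : ℝ) ∂(weightLaw F G.graph) =
      1 / 2 * G.average fun o => value F ψ G.graph o (mwmInd ⊤) := by
    intro G
    simp_rw [FiniteGraph.finsum_indicator_mwm, integral_div, integral_const_mul]
    rw [integral_finsetSum _ fun o _ => hint G o, FiniteGraph.average, mul_div_assoc]
    rfl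
  unfold expect FiniteExpect
  simp_rw [hroot, hval]
  refine ⟨fun n => ⟨Eventually.of_forall fun G => ⟨?_, ?_⟩, (iG n).const_mul _⟩,
    ⟨Eventually.of_forall fun g => ⟨?_, ?_⟩, ig⟩, ?_⟩
  · filter_upwards [ae_forall_weight_nonneg F (G := G.graph) hψ0] with w hw
    exact div_nonneg (finsum_nonneg fun e => Set.indicator_nonneg (fun e _ => hw e) e)
      G.numVerts_pos.le
  · simp_rw [FiniteGraph.finsum_indicator_mwm]
    exact ((integrable_finsetSum _ fun o _ => hint G o).const_mul _).div_const _
  · have := g.countable_V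
    filter_upwards [ae_forall_weight_nonneg F (G := g.graph) hψ0] with w hw
    refine finsum_nonneg fun v => mul_nonneg ?_ (hw _)
    exact Set.indicator_nonneg (fun _ _ => zero_le_one) _
  · have := g.countable_V
    exact integrable_rootSum (g.locallyFinite _) F hψi (measurable_limitInd (H g))
      (abs_limitInd_le_one (H g))
  · simp_rw [integral_const_mul]
    exact ht.const_mul _

end Convergence

end MaxMatching

/-! ### The theorem -/

open MaxMatching

theorem mainTheorem5
    -- the law of the edge weights
    (F : Measure ℝ) [IsProbabilityMeasure F] [NullSingletonClass F] (hF : F (Set.Iio 0) = 0)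
    (p : ℝ) (hp : 1 < p) (hmoment : Integrable (fun x : ℝ => |x| ^ p) F)
    -- the laws of the finite random graphs and of the limit
    (ν : ℕ → Measure FiniteGraph) [∀ n, IsProbabilityMeasure (ν n)]
    (μ : Measure RootedGraph) [IsProbabilityMeasure μ]
    (hconv : LocalWeakConvergence ν μ)
    (hratio : (⨆ n, ∫⁻ G, ((G.numEdges : ENNReal) / (G.numVerts : ENNReal)) ∂(ν n)) < ⊤)
    (hdecay : ∀ᵐ g ∂μ, CorrelationDecay F g.graph)
    -- the exhaustions along which the matching of the limit graph is constructed
    (H : ∀ g : RootedGraph, ℕ → g.graph.Subgraph) (hH : ∀ g, IsExhaustion (H g)) :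
    ((∀ n, FiniteExpect (ν n) (fun G => weightLaw F G.graph)
        (fun G w => G.maxWeight w / (G.numVerts : ℝ))) ∧
      FiniteExpect μ (fun g => weightLaw F g.graph)
        (fun g w => g.rootWeight (limitMWM (H g) w) w) ∧
      Tendsto (fun n => expect (ν n) (fun G => weightLaw F G.graph)
          (fun G w => G.maxWeight w / (G.numVerts : ℝ))) atTop
        (𝓝 (1 / 2 * expect μ (fun g => weightLaw F g.graph)
          (fun g w => g.rootWeight (limitMWM (H g) w) w)))) ∧
    ((∀ n, FiniteExpect (ν n) (fun G => weightLaw F G.graph)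
        (fun G w => (G.matchingSize w : ℝ) / (G.numVerts : ℝ))) ∧
      FiniteExpect μ (fun g => weightLaw F g.graph)
        (fun g w => g.rootCount (limitMWM (H g) w)) ∧
      Tendsto (fun n => expect (ν n) (fun G => weightLaw F G.graph)
          (fun G w => (G.matchingSize w : ℝ) / (G.numVerts : ℝ))) atTop
        (𝓝 (1 / 2 * expect μ (fun g => weightLaw F g.graph)
          (fun g w => g.rootCount (limitMWM (H g) w))))) := by

  have hF0 : ∀ᵐ x ∂F, 0 ≤ x := by
    rw [ae_iff]
    simpa [Set.Iio] using hF
  have hid : Integrable (fun x : ℝ => x) F := by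
    -- The moment of order `p` gives a first moment through `|x| ≤ 1 + |x| ^ p`.
    refine ((integrable_const (1 : ℝ)).add hmoment).mono' measurable_id.aestronglyMeasurable
      (Eventually.of_forall fun x => ?_)
    simp only [Real.norm_eq_abs, Pi.add_apply]
    rcases le_total |x| 1 with h | h
    · have : 0 ≤ |x| ^ p := by positivity
      linarith
    · linarith [Real.self_le_rpow_of_one_le h hp.le]
  -- Weight and size of the matching are the cases `ψ = id` and `ψ = 1` of the same convergence.
  have h₁ := tendsto_expect_matching F hconv hratio hdecay hH (ψ := fun x => x) measurable_id hid hF0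
  have h₂ := tendsto_expect_matching F hconv hratio hdecay hH (ψ := fun _ => 1) measurable_const
    (integrable_const _) (Eventually.of_forall fun _ => zero_le_one)
  unfold FiniteGraph.maxWeight RootedGraph.rootCount
  simp_rw [FiniteGraph.matchingSize_eq]
  exact ⟨h₁, h₂⟩
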